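/- For a finite nonempty set $A\subset\mathbb{R}$ let $\delta_A=\frac{1}{\#A}\sum_{a\in A}\delta_a$, and let $D_n=\{0,1,\dots,n-1\}$. A compactly supported Borel probability measure $\nu$ on $\mathbb{R}$ is called spectral if there is a countable set $\Lambda\subset\mathbb{R}$ such that $\{e^{2\pi i\lambda x}:\lambda\in\Lambda\}$ is an orthonormal basis of $L^2(\nu)$. **Theorem 5.5 (necessity).** Let $\{b_k\}_{k\ge1}$ and $\{p_k\}_{k\ge1}$ be sequences of positive integers with $b_k\ge 2p_k$ for all $k\ge1$. Put $$b''_1=b_1,\qquad b''_2=b_2,\qquad b''_{2k+1}=\frac{2}{b_{k+1}(2p_k-1)-1},\qquad b''_{2k+2}=\frac{b_{k+2}\,\bigl(b_{k+1}(2p_k-1)-1\bigr)}{2}\qquad(k\ge1),$$ $$p''_1=p_1,\qquad p''_2=p_2,\qquad p''_{2k+1}=2,\qquad p''_{2k+2}=p_{k+2}\qquad(k\ge1),$$ and let $\nu$ be the infinite convolution (the weak limit of the finite convolutions) $$\nu=\delta_{(b''_1)^{-1}D_{p''_1}}*\delta_{(b''_1b''_2)^{-1}D_{p''_2}}*\delta_{(b''_1b''_2b''_3)^{-1}D_{p''_3}}*\cdots.$$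 Suppose that $p_k$ is even for all $k\ge1$ and that $\{b_k\}_{k\ge1}$ is bounded. If $\nu$ is a spectral measure, then $p_2\mid b_2$ and $2p_k\mid b_k$ for all $k\ge3$. -/

import Mathlib

open MeasureTheory Filter Topology

noncomputable section

namespace MoranSpectral

/-- The uniform probability measure on a finite set `A` of reals:
the average of the Dirac measures at the points of `A`. -/
def uniformOnDigits (A : Finset ℝ) : Measure ℝ :=
  (A.card : ENNReal)⁻¹ • ∑ a ∈ A, Measure.dirac a

/-- The scaled consecutive digit set `s⁻¹ {0, 1, …, n - 1}`. -/
def scaledDigits (s : ℝ) (n : ℕ) : Finset ℝ :=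
  (Finset.range n).image fun j : ℕ => s⁻¹ * (j : ℝ)

/-- The finite convolution `μ₁ * μ₂ * ⋯ * μₙ` (indices start at `1`). -/
def partialConv (μ : ℕ → Measure ℝ) : ℕ → Measure ℝ
  | 0 => Measure.dirac 0
  | n + 1 => (partialConv μ n).conv (μ (n + 1))

/-- `ν` is the infinite convolution `μ₁ * μ₂ * ⋯`, that is, the weak limit of the
finite convolutions `μ₁ * ⋯ * μₙ`. -/
def IsInfiniteConvolution (μ : ℕ → Measure ℝ) (ν : Measure ℝ) : Prop :=
  ∀ f : BoundedContinuousFunction ℝ ℝ,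
    Tendsto (fun n => ∫ x, f x ∂(partialConv μ n)) atTop (𝓝 (∫ x, f x ∂ν))

/-- A spectral measure: a compactly supported Borel probability measure `μ` on `ℝ` such that
for some countable `Λ ⊆ ℝ` the exponentials `x ↦ exp (2 π i l x)`, `l ∈ Λ`, form an
orthonormal (Hilbert) basis of `L²(μ)`. -/
def IsSpectralMeasure (μ : Measure ℝ) : Prop :=
  IsProbabilityMeasure μ ∧ (∃ K : Set ℝ, IsCompact K ∧ μ Kᶜ = 0) ∧
    ∃ Λ : Set ℝ, Λ.Countable ∧ ∃ e : HilbertBasis Λ ℂ (Lp ℂ 2 μ),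
      ∀ l : Λ, ⇑(e l) =ᵐ[μ]
        fun x : ℝ => Complex.exp (2 * Real.pi * Complex.I * ((l : ℝ) : ℂ) * (x : ℂ))

/-- The ratios `b''ₖ` (for `k ≥ 1`): `b''₁ = b₁`, `b''₂ = b₂` and, for `k ≥ 1`,
`b''₂ₖ₊₁ = 2 / (bₖ₊₁ (2 pₖ - 1) - 1)`, `b''₂ₖ₊₂ = bₖ₊₂ (bₖ₊₁ (2 pₖ - 1) - 1) / 2`.
The value at index `0` is never used. -/
def ratio (b p : ℕ → ℕ) (n : ℕ) : ℚ :=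
  if n ≤ 2 then b n
  else if Odd n then
    2 / ((b ((n - 1) / 2 + 1) : ℚ) * (2 * (p ((n - 1) / 2) : ℚ) - 1) - 1)
  else
    (b ((n - 1) / 2 + 2) : ℚ) *
      ((b ((n - 1) / 2 + 1) : ℚ) * (2 * (p ((n - 1) / 2) : ℚ) - 1) - 1) / 2

/-- The digit numbers `p''ₖ` (for `k ≥ 1`): `p''₁ = p₁`, `p''₂ = p₂` and, for `k ≥ 1`,
`p''₂ₖ₊₁ = 2`, `p''₂ₖ₊₂ = pₖ₊₂`. The value at index `0` is never used. -/
def digitCount (p : ℕ → ℕ) (n : ℕ) : ℕ :=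
  if n ≤ 2 then p n else if Odd n then 2 else p ((n - 1) / 2 + 2)

/-- The product `b''₁ b''₂ ⋯ b''ₖ`, as a real number. -/
def scale (b p : ℕ → ℕ) (k : ℕ) : ℝ := ((∏ i ∈ Finset.Icc 1 k, ratio b p i : ℚ) : ℝ)

/-- The `k`-th factor of the infinite convolution (`k ≥ 1`): the uniform measure on
`(b''₁ ⋯ b''ₖ)⁻¹ {0, 1, …, p''ₖ - 1}`. -/
def factor (b p : ℕ → ℕ) (k : ℕ) : Measure ℝ :=
  uniformOnDigits (scaledDigits (scale b p k) (digitCount p k))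

theorem ratio_one (b p : ℕ → ℕ) : ratio b p 1 = b 1 := by simp [ratio]

theorem ratio_two (b p : ℕ → ℕ) : ratio b p 2 = b 2 := by simp [ratio]

theorem ratio_odd (b p : ℕ → ℕ) (k : ℕ) (hk : 1 ≤ k) :
    ratio b p (2 * k + 1) = 2 / ((b (k + 1) : ℚ) * (2 * (p k : ℚ) - 1) - 1) := by
  have h1 : ¬ (2 * k + 1 ≤ 2) := by omega
  have h2 : (2 * k + 1 - 1) / 2 = k := by omega
  have h3 : Odd (2 * k + 1) := ⟨k, rfl⟩
  simp only [ratio, h1, h2, h3, if_true, if_false]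

theorem ratio_even (b p : ℕ → ℕ) (k : ℕ) (hk : 1 ≤ k) :
    ratio b p (2 * k + 2) =
      (b (k + 2) : ℚ) * ((b (k + 1) : ℚ) * (2 * (p k : ℚ) - 1) - 1) / 2 := by
  have h1 : ¬ (2 * k + 2 ≤ 2) := by omega
  have h2 : (2 * k + 2 - 1) / 2 = k := by omega
  have h3 : ¬ Odd (2 * k + 2) := by
    rw [Nat.not_odd_iff_even]; exact ⟨k + 1, by ring⟩
  simp only [ratio, h1, h2, h3, if_false]

theorem digitCount_one (p : ℕ → ℕ) : digitCount p 1 = p 1 := by simp [digitCount]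

theorem digitCount_two (p : ℕ → ℕ) : digitCount p 2 = p 2 := by simp [digitCount]

theorem digitCount_odd (p : ℕ → ℕ) (k : ℕ) (hk : 1 ≤ k) : digitCount p (2 * k + 1) = 2 := by
  have h1 : ¬ (2 * k + 1 ≤ 2) := by omega
  have h3 : Odd (2 * k + 1) := ⟨k, rfl⟩
  simp only [digitCount, h1, h3, if_true, if_false]

theorem digitCount_even (p : ℕ → ℕ) (k : ℕ) (hk : 1 ≤ k) :
    digitCount p (2 * k + 2) = p (k + 2) := by
  have h1 : ¬ (2 * k + 2 ≤ 2) := by omega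
  have h2 : (2 * k + 2 - 1) / 2 = k := by omega
  have h3 : ¬ Odd (2 * k + 2) := by
    rw [Nat.not_odd_iff_even]; exact ⟨k + 1, by ring⟩
  simp only [digitCount, h1, h2, h3, if_false]

theorem isProbabilityMeasure_uniformOnDigits (A : Finset ℝ) (hA : A.Nonempty) :
    IsProbabilityMeasure (uniformOnDigits A) := by
  constructor
  have h0 : (A.card : ENNReal) ≠ 0 := by simpa using hA.ne_empty
  simp [uniformOnDigits, ENNReal.inv_mul_cancel h0]

theorem ae_mem_uniformOnDigits (A : Finset ℝ) : ∀ᵐ x ∂(uniformOnDigits A), x ∈ A := by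
  rw [ae_iff]
  have hm : MeasurableSet {x : ℝ | ¬ x ∈ A} := A.measurableSet.compl
  simp only [uniformOnDigits, Measure.smul_apply, Measure.finsetSum_apply, smul_eq_mul]
  rw [Finset.sum_eq_zero, mul_zero]
  intro a ha
  rw [Measure.dirac_apply' _ hm]
  simp [ha]

theorem partialConv_eq_map (μ : ℕ → Measure ℝ) [∀ i, IsProbabilityMeasure (μ (i + 1))] (n : ℕ) :
    partialConv μ n = (Measure.infinitePi fun i => μ (i + 1)).map
      (fun ω : ℕ → ℝ => ∑ i ∈ Finset.range n, ω i) := by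
  have hind : ProbabilityTheory.iIndepFun (fun (i : ℕ) (ω : ℕ → ℝ) => ω i)
      (Measure.infinitePi fun i => μ (i + 1)) :=
    ProbabilityTheory.iIndepFun_infinitePi (P := fun i => μ (i + 1)) (X := fun _ x => x)
      (fun _ => measurable_id)
  induction n with
  | zero => simp [partialConv]
  | succ n ih =>
    have h := (hind.indepFun_finsetSum_of_notMem₀ (fun i => (measurable_pi_apply i).aemeasurable)
      (s := Finset.range n) (i := n) (by simp))
    have h2 := h.map_add_eq_map_conv_map (by fun_prop) (by fun_prop)
    have h3 : Measure.map (fun ω : ℕ → ℝ => ω n) (Measure.infinitePi fun i => μ (i + 1))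
        = μ (n + 1) := Measure.infinitePi_map_eval (fun i => μ (i + 1)) n
    have h4 : (∑ j ∈ Finset.range n, fun ω : ℕ → ℝ => ω j)
        = fun ω : ℕ → ℝ => ∑ i ∈ Finset.range n, ω i := by
      ext ω; simp
    rw [h4, h3, ← ih] at h2
    rw [partialConv, ← h2]
    congr 1
    ext ω
    simp [Finset.sum_range_succ]

theorem exists_infiniteConvolution (μ : ℕ → Measure ℝ)
    [∀ i, IsProbabilityMeasure (μ (i + 1))] (c : ℕ → ℝ) (hc : Summable c)
    (hμ : ∀ i, ∀ᵐ x ∂(μ (i + 1)), x ∈ Set.Icc 0 (c i)) :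
    ∃ ν : Measure ℝ, IsProbabilityMeasure ν ∧ (∃ K : Set ℝ, IsCompact K ∧ ν Kᶜ = 0) ∧
      IsInfiniteConvolution μ ν := by
  set P := Measure.infinitePi fun i => μ (i + 1) with hP
  have hae : ∀ᵐ ω ∂P, ∀ i, ω i ∈ Set.Icc 0 (c i) := by
    rw [ae_all_iff]
    intro i
    exact (measurePreserving_eval_infinitePi (fun i => μ (i + 1)) i).quasiMeasurePreserving.ae
      (hμ i)
  have hsum : ∀ᵐ ω ∂P, Summable ω ∧ (∑' i, ω i) ∈ Set.Icc 0 (∑' i, c i) := by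
    filter_upwards [hae] with ω hω
    have hs : Summable ω := Summable.of_nonneg_of_le (fun i => (hω i).1) (fun i => (hω i).2) hc
    exact ⟨hs, tsum_nonneg fun i => (hω i).1, hs.tsum_le_tsum (fun i => (hω i).2) hc⟩
  have hX : AEMeasurable (fun ω : ℕ → ℝ => ∑' i, ω i) P := by
    refine aemeasurable_of_tendsto_metrizable_ae atTop
      (f := fun n (ω : ℕ → ℝ) => ∑ i ∈ Finset.range n, ω i) (fun n => by fun_prop) ?_
    filter_upwards [hsum] with ω hω
    exact hω.1.hasSum.tendsto_sum_nat
  refine ⟨P.map (fun ω : ℕ → ℝ => ∑' i, ω i), Measure.isProbabilityMeasure_map hX,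
    ⟨Set.Icc 0 (∑' i, c i), isCompact_Icc, ?_⟩, ?_⟩
  · rw [Measure.map_apply_of_aemeasurable hX measurableSet_Icc.compl]
    have := hsum
    rw [ae_iff] at this
    refine measure_mono_null ?_ this
    intro ω hω h
    exact hω h.2
  · intro f
    rw [integral_map hX f.continuous.aestronglyMeasurable]
    have : ∀ n, ∫ x, f x ∂(partialConv μ n)
        = ∫ ω : ℕ → ℝ, f (∑ i ∈ Finset.range n, ω i) ∂P := by
      intro n
      rw [partialConv_eq_map, integral_map (by fun_prop) f.continuous.aestronglyMeasurable]
    simp only [this]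
    refine tendsto_integral_of_dominated_convergence (fun _ => ‖f‖) (fun n => ?_)
      (integrable_const _) (fun n => Eventually.of_forall fun ω => f.norm_coe_le_norm _) ?_
    · exact (f.continuous.measurable.comp (by fun_prop)).aestronglyMeasurable
    · filter_upwards [hsum] with ω hω
      exact (f.continuous.tendsto _).comp hω.1.hasSum.tendsto_sum_nat

theorem scale_succ (b p : ℕ → ℕ) (k : ℕ) :
    scale b p (k + 1) = scale b p k * ((ratio b p (k + 1) : ℚ) : ℝ) := by
  simp [scale, Finset.prod_Icc_succ_top]

/-- Telescoping: `b''₁ ⋯ b''₂ₖ = b₁ ⋯ bₖ₊₁` for `k ≥ 1`. -/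
theorem scale_even (b p : ℕ → ℕ)
    (hp_pos : ∀ k, 1 ≤ k → 1 ≤ p k) (hbp : ∀ k, 1 ≤ k → 2 * p k ≤ b k) (k : ℕ) (hk : 1 ≤ k) :
    scale b p (2 * k) = ∏ i ∈ Finset.Icc 1 (k + 1), (b i : ℝ) := by
  induction k, hk using Nat.le_induction with
  | base =>
    rw [show 2 * 1 = 0 + 1 + 1 from rfl, scale_succ, scale_succ]
    simp [scale, ratio_one, ratio_two, Finset.prod_Icc_succ_top]
  | succ k hk ih =>
    have e : 2 * (k + 1) = 2 * k + 1 + 1 := by ring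
    rw [e, scale_succ, scale_succ, ih, show 2 * k + 1 + 1 = 2 * k + 2 from rfl,
      ratio_even b p k hk, ratio_odd b p k hk, Finset.prod_Icc_succ_top (by omega : 1 ≤ k + 1 + 1)]
    have h1 : (1 : ℝ) ≤ p k := by exact_mod_cast hp_pos k hk
    have h2 : (2 : ℝ) ≤ b (k + 1) := by
      have := hbp (k + 1) (by omega)
      have := hp_pos (k + 1) (by omega)
      exact_mod_cast (by omega : 2 ≤ b (k + 1))
    have h3 : (b (k + 1) : ℝ) * (2 * (p k : ℝ) - 1) - 1 ≠ 0 := by nlinarith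
    push_cast
    field_simp
    try ring

theorem two_pow_le_prod (b p : ℕ → ℕ)
    (hp_pos : ∀ k, 1 ≤ k → 1 ≤ p k) (hbp : ∀ k, 1 ≤ k → 2 * p k ≤ b k) (k : ℕ) :
    (2 : ℝ) ^ k ≤ ∏ i ∈ Finset.Icc 1 k, (b i : ℝ) := by
  induction k with
  | zero => simp
  | succ k ih =>
    rw [Finset.prod_Icc_succ_top (by omega), pow_succ]
    have h2 : (2 : ℝ) ≤ b (k + 1) := by
      have := hbp (k + 1) (by omega)
      have := hp_pos (k + 1) (by omega)
      exact_mod_cast (by omega : 2 ≤ b (k + 1))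
    exact mul_le_mul ih h2 (by norm_num) (le_trans (by positivity) ih)

/-- The largest digit of each factor is small. -/
theorem digit_bound (b p : ℕ → ℕ)
    (hp_pos : ∀ k, 1 ≤ k → 1 ≤ p k) (hbp : ∀ k, 1 ≤ k → 2 * p k ≤ b k) (n : ℕ) (hn : 1 ≤ n) :
    0 < scale b p n ∧
      (scale b p n)⁻¹ * ((digitCount p n : ℝ) - 1) ≤ 2 * (1 / 2 : ℝ) ^ (n / 2) := by
  have hb2 : ∀ k, 1 ≤ k → (2 : ℝ) * p k ≤ b k := fun k hk => by exact_mod_cast hbp k hk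
  have hp1 : ∀ k, 1 ≤ k → (1 : ℝ) ≤ p k := fun k hk => by exact_mod_cast hp_pos k hk
  rcases Nat.lt_or_ge n 2 with h | h
  · obtain rfl : n = 1 := by omega
    have h1 := hb2 1 le_rfl
    have h2 := hp1 1 le_rfl
    have hs : scale b p 1 = b 1 := by simp [scale, ratio_one]
    have hpos : (0 : ℝ) < b 1 := by linarith
    refine ⟨by rw [hs]; exact hpos, ?_⟩
    rw [hs, digitCount_one, inv_mul_le_iff₀ hpos]
    norm_num
    linarith
  · rcases Nat.even_or_odd' n with ⟨k, rfl | rfl⟩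
    · have hk : 1 ≤ k := by omega
      have hd : digitCount p (2 * k) = p (k + 1) := by
        obtain ⟨j, rfl⟩ : ∃ j, k = j + 1 := ⟨k - 1, by omega⟩
        rcases Nat.eq_zero_or_pos j with rfl | hj
        · exact digitCount_two p
        · exact digitCount_even p j hj
      have hB := two_pow_le_prod b p hp_pos hbp k
      have h1 := hb2 (k + 1) (by omega)
      have h2 := hp1 (k + 1) (by omega)
      rw [scale_even b p hp_pos hbp k hk, hd, Finset.prod_Icc_succ_top (by omega)]
      set S := ∏ i ∈ Finset.Icc 1 k, (b i : ℝ)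
      have hS : 0 < S := lt_of_lt_of_le (by positivity) hB
      have hb : (0 : ℝ) < b (k + 1) := by linarith
      refine ⟨by positivity, ?_⟩
      rw [inv_mul_le_iff₀ (by positivity), show 2 * k / 2 = k by omega]
      have h5 : 1 ≤ S * (1 / 2 : ℝ) ^ k := by
        calc (1 : ℝ) = 2 ^ k * (1 / 2 : ℝ) ^ k := by rw [← mul_pow]; norm_num
          _ ≤ _ := by gcongr
      nlinarith
    · have hk : 1 ≤ k := by omega
      have hB := two_pow_le_prod b p hp_pos hbp k
      have h1 := hb2 k hk
      have h2 := hp1 k hk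
      have h1' := hb2 (k + 1) (by omega)
      have h2' := hp1 (k + 1) (by omega)
      have hsplit : ∏ i ∈ Finset.Icc 1 k, (b i : ℝ) =
          (∏ i ∈ Finset.Icc 1 (k - 1), (b i : ℝ)) * b k := by
        obtain ⟨j, rfl⟩ : ∃ j, k = j + 1 := ⟨k - 1, by omega⟩
        rw [Finset.prod_Icc_succ_top (by omega)]; rfl
      have hB' := two_pow_le_prod b p hp_pos hbp (k - 1)
      rw [scale_succ, scale_even b p hp_pos hbp k hk, digitCount_odd p k hk, ratio_odd b p k hk,
        Finset.prod_Icc_succ_top (by omega), hsplit]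
      set S := ∏ i ∈ Finset.Icc 1 (k - 1), (b i : ℝ)
      have hS : 0 < S := lt_of_lt_of_le (by positivity) hB'
      have hb : (0 : ℝ) < b (k + 1) := by linarith
      have hbk : (0 : ℝ) < b k := by linarith
      have hM : 0 < (b (k + 1) : ℝ) * (2 * (p k : ℝ) - 1) - 1 := by nlinarith
      push_cast
      refine ⟨by positivity, ?_⟩
      rw [inv_mul_le_iff₀ (by positivity), show (2 * k + 1) / 2 = k by omega]
      have h5 : 1 ≤ 2 * (S * (1 / 2 : ℝ) ^ k) := by
        have : 2 * (S * (1 / 2 : ℝ) ^ k) = S * (1 / 2 : ℝ) ^ (k - 1) := by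
          obtain ⟨j, rfl⟩ : ∃ j, k = j + 1 := ⟨k - 1, by omega⟩
          rw [Nat.add_sub_cancel, pow_succ]; ring
        rw [this]
        calc (1 : ℝ) = 2 ^ (k - 1) * (1 / 2 : ℝ) ^ (k - 1) := by rw [← mul_pow]; norm_num
          _ ≤ _ := by gcongr
      rw [show (2 : ℝ) - 1 = 1 by norm_num]
      set M := (b (k + 1) : ℝ) * (2 * (p k : ℝ) - 1) - 1 with hMdef
      have hkey : M ≤ 2 * (b k * b (k + 1)) := by nlinarith
      have : S * b k * b (k + 1) * (2 / M) * (2 * (1 / 2 : ℝ) ^ k)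
          = (2 * (S * (1 / 2 : ℝ) ^ k)) * (2 * (b k * b (k + 1)) / M) := by ring
      rw [this]
      have h6 : 1 ≤ 2 * (b k * b (k + 1)) / M := (one_le_div hM).2 hkey
      nlinarith

set_option maxHeartbeats 1000000 in
/-- The infinite convolution exists, and it is a compactly supported probability measure. -/
theorem exists_measure (b p : ℕ → ℕ)
    (hp_pos : ∀ k, 1 ≤ k → 1 ≤ p k) (hbp : ∀ k, 1 ≤ k → 2 * p k ≤ b k) :
    ∃ ν : Measure ℝ, IsProbabilityMeasure ν ∧ (∃ K : Set ℝ, IsCompact K ∧ ν Kᶜ = 0) ∧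
      IsInfiniteConvolution (factor b p) ν := by
  have hd : ∀ n, 1 ≤ n → 1 ≤ digitCount p n := by
    intro n hn
    unfold digitCount
    split_ifs
    · exact hp_pos n hn
    · norm_num
    · exact hp_pos _ (by omega)
  have : ∀ i, IsProbabilityMeasure (factor b p (i + 1)) := fun i => by
    apply isProbabilityMeasure_uniformOnDigits
    rw [scaledDigits, Finset.image_nonempty, Finset.nonempty_range_iff]
    have := hd (i + 1) (by omega)
    omega
  have hsum : Summable fun n : ℕ => 2 * (1 / 2 : ℝ) ^ (n / 2) := by
    apply Summable.mul_left
    have h1 : Summable fun k : ℕ => (1 / 2 : ℝ) ^ (2 * k / 2) := by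
      simpa using summable_geometric_two
    have h2 : Summable fun k : ℕ => (1 / 2 : ℝ) ^ ((2 * k + 1) / 2) := by
      have : ∀ k : ℕ, (2 * k + 1) / 2 = k := fun k => by omega
      simpa only [this] using summable_geometric_two
    exact h1.even_add_odd h2
  refine exists_infiniteConvolution (factor b p) (fun i => 2 * (1 / 2 : ℝ) ^ ((i + 1) / 2))
    ((summable_nat_add_iff 1).2 hsum) (fun i => ?_)
  filter_upwards [ae_mem_uniformOnDigits (scaledDigits (scale b p (i + 1)) (digitCount p (i + 1)))]
    with x hx
  simp only [scaledDigits, Finset.mem_image, Finset.mem_range] at hx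
  obtain ⟨j, hj, rfl⟩ := hx
  obtain ⟨h1, h2⟩ := digit_bound b p hp_pos hbp (i + 1) (by omega)
  refine ⟨by positivity, le_trans ?_ h2⟩
  have : (j : ℝ) ≤ (digitCount p (i + 1) : ℝ) - 1 := by
    have : (j : ℝ) + 1 ≤ digitCount p (i + 1) := by exact_mod_cast hj
    linarith
  gcongr

end MoranSpectral

end

/-! Write `B_k = b_1 ⋯ b_k`. The ratios telescope, so the Fourier transform of the measure is the
product of the means `D_k` (`k ≥ 1`) of `p_k` consecutive digits at scale `B_k` and the means `E_k`
(`k ≥ 2`) of the two digits `0` and `m / (2 B_k)`, where `m = b_k (2 p_{k-1} - 1) - 1`.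

Two principles drive the argument. A factor of modulus `< 1` near `0`, except at `0`, cannot be
redundant for orthogonality: without it Bessel's inequality still holds, while restoring it makes
the Parseval sum strictly smaller (`IsAlmostSpectrum.false_of_factor`). A factor with `L`-periodic
modulus that vanishes on differences between distinct classes modulo `L` can be peeled off, and one
class then serves the remaining product (`IsAlmostSpectrum.split`). Peeling divides by a value of
the removed factor, which costs countably many frequencies; hence almost spectra instead of spectra.

Redundancy first shows that the `2`-part of `p_k` divides `b_k` for `k ≥ 2` (`exists_odd_dvd_mul`):
otherwise a two-digit piece of `D_k` vanishes only where `D_{k-1}` does. So `b_k` is even, `m` is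
odd, and every zero of the product beyond `D_k` is `B_k` times a fraction with odd denominator
(`mem_oddLocal_of_tailHat_eq_zero`). This `2`-adic gap allows `D_k` to be peeled off
(`IsAlmostSpectrum.split_consecutive`), leaving a coset of `B_k ℤ`; then `E_k`
(`IsAlmostSpectrum.split_pair`), leaving a coset of `2 B_k ℤ`.

Inside a coset of `L ℤ`, redundancy applied to the next consecutive digits, at scale `L c`, forces
their number to divide `c` (`IsAlmostSpectrum.dvd`). With `L = B_1`, `c = b_2` this is the claim for
`p_2`; with `L = 2 B_{k-1}`, `c = b_k / 2` it is the claim for `k ≥ 3`. -/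

namespace MoranSpectral

/-! ### Exponentials and Fourier transforms of probability measures. -/

/-- The exponential `exp (2 π i l x)`, as a function of `x`. -/
noncomputable def expo (l x : ℝ) : ℂ :=
  Complex.exp (2 * Real.pi * Complex.I * (l : ℂ) * (x : ℂ))

/-- The Fourier transform `∫ exp (2 π i ξ x) ∂μ(x)`. -/
noncomputable def fourierAt (μ : Measure ℝ) (ξ : ℝ) : ℂ := charFun μ (2 * Real.pi * ξ)

theorem expo_eq (l x : ℝ) : expo l x = Complex.exp (((2 * Real.pi * (l * x) : ℝ) : ℂ) * Complex.I) := by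
  unfold expo; congr 1; push_cast; ring

theorem fourierAt_eq (μ : Measure ℝ) (ξ : ℝ) : fourierAt μ ξ = ∫ x, expo ξ x ∂μ := by
  rw [fourierAt, charFun_apply_real]
  refine integral_congr_ae (Eventually.of_forall fun x => ?_)
  simp only [expo]; congr 1; push_cast; ring

theorem continuous_expo (l : ℝ) : Continuous (expo l) := by
  unfold expo; fun_prop

theorem norm_expo (l x : ℝ) : ‖expo l x‖ = 1 := by
  rw [expo_eq]; exact Complex.norm_exp_ofReal_mul_I _

theorem conj_expo (l x : ℝ) : (starRingEnd ℂ) (expo l x) = expo (-l) x := by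
  rw [expo, expo, ← Complex.exp_conj]; congr 1
  simp only [map_mul, Complex.conj_I, Complex.conj_ofReal, map_ofNat]; push_cast; ring

theorem expo_add (k l x : ℝ) : expo (k + l) x = expo k x * expo l x := by
  rw [expo, expo, expo, ← Complex.exp_add]; congr 1; push_cast; ring

theorem expo_conj_mul (k l x : ℝ) : expo l x * (starRingEnd ℂ) (expo k x) = expo (l - k) x := by
  rw [conj_expo, ← expo_add, sub_eq_add_neg]

theorem expo_one_natCast_mul (n : ℕ) (x : ℝ) : expo 1 (n * x) = expo 1 x ^ n := by
  rw [expo, expo, ← Complex.exp_nat_mul]; congr 1; push_cast; ring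

theorem expo_one_eq_one_iff (x : ℝ) : expo 1 x = 1 ↔ ∃ n : ℤ, x = n := by
  rw [expo, Complex.exp_eq_one_iff]
  have hpi : (2 * Real.pi * Complex.I : ℂ) ≠ 0 := by simp [Real.pi_ne_zero]
  refine exists_congr fun n => ?_
  rw [show (2 * Real.pi * Complex.I * ((1 : ℝ) : ℂ) * (x : ℂ) : ℂ) = (x : ℂ) * (2 * Real.pi * Complex.I) by
    push_cast; ring, mul_left_inj' hpi]
  norm_cast

theorem memLp_expo (μ : Measure ℝ) [IsProbabilityMeasure μ] (l : ℝ) : MemLp (expo l) 2 μ :=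
  MemLp.of_bound (continuous_expo l).aestronglyMeasurable 1
    (Eventually.of_forall fun x => (norm_expo l x).le)

/-- The class in `L²(μ)` of an exponential. -/
noncomputable def expoLp (μ : Measure ℝ) [IsProbabilityMeasure μ] (l : ℝ) : Lp ℂ 2 μ :=
  (memLp_expo μ l).toLp

theorem inner_expoLp (μ : Measure ℝ) [IsProbabilityMeasure μ] (k l : ℝ) :
    inner ℂ (expoLp μ k) (expoLp μ l) = fourierAt μ (l - k) := by
  rw [L2.inner_def, fourierAt_eq]
  refine integral_congr_ae ?_
  filter_upwards [(memLp_expo μ k).coeFn_toLp, (memLp_expo μ l).coeFn_toLp] with x hx hy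
  rw [expoLp, expoLp, hx, hy, RCLike.inner_apply, expo_conj_mul]

theorem fourierAt_zero (μ : Measure ℝ) [IsProbabilityMeasure μ] : fourierAt μ 0 = 1 := by
  simp [fourierAt]

/-- `φ` is the Fourier transform of a probability measure. -/
def IsFourier (φ : ℝ → ℂ) : Prop :=
  ∃ μ : Measure ℝ, IsProbabilityMeasure μ ∧ ∀ ξ, φ ξ = fourierAt μ ξ

theorem IsFourier.zero {φ : ℝ → ℂ} (h : IsFourier φ) : φ 0 = 1 := by
  obtain ⟨μ, _, hμ⟩ := h
  rw [hμ, fourierAt_zero]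

theorem IsFourier.continuous {φ : ℝ → ℂ} (h : IsFourier φ) : Continuous φ := by
  obtain ⟨μ, _, hμ⟩ := h
  rw [funext hμ]
  unfold fourierAt
  fun_prop

theorem IsFourier.mul {φ ψ : ℝ → ℂ} (h : IsFourier φ) (h' : IsFourier ψ) :
    IsFourier fun x => φ x * ψ x := by
  obtain ⟨μ, _, hμ⟩ := h
  obtain ⟨ν, _, hν⟩ := h'
  refine ⟨μ.conv ν, inferInstance, fun ξ => ?_⟩
  simp only [hμ, hν, fourierAt, charFun_conv]

theorem isFourier_one : IsFourier fun _ => 1 :=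
  ⟨Measure.dirac 0, inferInstance, fun ξ => by simp [fourierAt, charFun_apply]⟩

theorem IsFourier.prod {φ : ℕ → ℝ → ℂ} (s : Finset ℕ) (h : ∀ i ∈ s, IsFourier (φ i)) :
    IsFourier fun x => ∏ i ∈ s, φ i x := by
  classical
  induction s using Finset.induction_on with
  | empty => simpa using isFourier_one
  | insert a s ha ih =>
    simp only [Finset.prod_insert ha]
    exact (h a (by simp)).mul (ih fun i hi => h i (by simp [hi]))

/-! ### Bessel's inequality, almost spectra, redundant and periodic factors. -/

/-- Bessel's inequality for a set of exponentials orthogonal with respect to `φ`. -/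
theorem IsFourier.sum_sq_le {φ : ℝ → ℂ} (h : IsFourier φ) (s : Finset ℝ)
    (hs : ∀ x ∈ s, ∀ y ∈ s, x ≠ y → φ (x - y) = 0) (ξ : ℝ) :
    ∑ l ∈ s, ‖φ (ξ - l)‖ ^ 2 ≤ 1 := by
  obtain ⟨μ, _, hμ⟩ := h
  classical
  have ho : Orthonormal ℂ fun l : s => expoLp μ l := by
    rw [orthonormal_iff_ite]
    intro i j
    rw [inner_expoLp]
    split_ifs with hij
    · rw [hij, sub_self, fourierAt_zero]
    · rw [← hμ]
      exact hs _ j.2 _ i.2 fun e => hij (Subtype.ext e.symm)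
  have := ho.sum_inner_products_le (expoLp μ ξ) (s := Finset.univ)
  simp only [inner_expoLp, ← hμ] at this
  rw [Finset.univ_eq_attach, Finset.sum_attach s fun l => ‖φ (ξ - l)‖ ^ 2] at this
  refine this.trans ?_
  have h1 : ‖expoLp μ ξ‖ ^ 2 = 1 := by
    have := inner_self_eq_norm_sq_to_K (𝕜 := ℂ) (expoLp μ ξ)
    rw [inner_expoLp, sub_self, fourierAt_zero] at this
    exact Complex.ofReal_injective (by simpa using this.symm)
  rw [h1]

/-- `Λ` is orthogonal with respect to `φ`, and Parseval's identity holds for all exponentials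
outside a countable set of frequencies. -/
structure IsAlmostSpectrum (φ : ℝ → ℂ) (Λ : Set ℝ) : Prop where
  nonempty : Λ.Nonempty
  orth : ∀ x ∈ Λ, ∀ y ∈ Λ, x ≠ y → φ (x - y) = 0
  parseval : ∃ N : Set ℝ, N.Countable ∧ ∀ ξ, ξ ∉ N → HasSum (fun l : Λ => ‖φ (ξ - l)‖ ^ 2) 1

theorem IsFourier.summable_sq {φ : ℝ → ℂ} (h : IsFourier φ) {Λ : Set ℝ}
    (hΛ : ∀ x ∈ Λ, ∀ y ∈ Λ, x ≠ y → φ (x - y) = 0) (ξ : ℝ) :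
    Summable (fun l : Λ => ‖φ (ξ - l)‖ ^ 2) ∧ ∑' l : Λ, ‖φ (ξ - l)‖ ^ 2 ≤ 1 := by
  have key : ∀ s : Finset Λ, ∑ l ∈ s, ‖φ (ξ - l)‖ ^ 2 ≤ 1 := by
    intro s
    have := h.sum_sq_le (s.map (Function.Embedding.subtype _)) ?_ ξ
    · simpa using this
    · intro x hx y hy
      simp only [Finset.mem_map, Function.Embedding.subtype_apply] at hx hy
      obtain ⟨a, -, rfl⟩ := hx
      obtain ⟨b, -, rfl⟩ := hy
      exact hΛ _ a.2 _ b.2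
  exact ⟨summable_of_sum_le (fun _ => by positivity) key,
    Real.tsum_le_of_sum_le (fun _ => by positivity) key⟩

/-- Parseval's identity for the unit vector `expoLp ν ξ`, whose coefficients are values of the
Fourier transform at `ξ - l` up to conjugation. The exceptional set is empty here. -/
theorem exists_isAlmostSpectrum {ν : Measure ℝ} (h : IsSpectralMeasure ν) :
    ∃ Λ, IsAlmostSpectrum (fourierAt ν) Λ := by
  obtain ⟨_, -, Λ, -, e, he⟩ := h
  have hE : ∀ l : Λ, e l = expoLp ν l := fun l => by
    apply Lp.ext
    filter_upwards [he l, (memLp_expo ν l).coeFn_toLp] with x hx hy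
    rw [hx, expoLp, hy, expo]
  have hP : ∀ ξ, HasSum (fun l : Λ => ‖fourierAt ν (ξ - l)‖ ^ 2) 1 := by
    intro ξ
    have := e.hasSum_inner_mul_inner (expoLp ν ξ) (expoLp ν ξ)
    rw [inner_expoLp, sub_self, fourierAt_zero] at this
    have h2 : ∀ l : Λ, inner ℂ (expoLp ν ξ) (e l) * inner ℂ (e l) (expoLp ν ξ)
        = ((‖fourierAt ν (ξ - l)‖ ^ 2 : ℝ) : ℂ) := by
      intro l
      rw [← inner_conj_symm, hE, inner_expoLp, RCLike.conj_mul]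
      push_cast; rfl
    simp only [h2] at this
    simpa only [Complex.reCLM_apply, Complex.ofReal_re, Complex.one_re] using
      Complex.reCLM.hasSum this
  refine ⟨Λ, ?_, ?_, ∅, Set.countable_empty, fun ξ _ => hP ξ⟩
  · rw [← Set.nonempty_coe_sort]
    by_contra hne
    rw [not_nonempty_iff] at hne
    exact zero_ne_one (hasSum_empty.unique (hP 0))
  · intro x hx y hy hxy
    have : inner ℂ (e ⟨y, hy⟩) (e ⟨x, hx⟩) = 0 :=
      e.orthonormal.2 fun h => hxy (by simpa using h.symm)
    rwa [hE, hE, inner_expoLp] at this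

/-- A factor of the measure that is not needed for orthogonality destroys completeness. -/
theorem IsAlmostSpectrum.false_of_factor {φ h σ : ℝ → ℂ} {Λ : Set ℝ}
    (hΛ : IsAlmostSpectrum φ Λ) (hφ : ∀ x, φ x = h x * σ x) (hσ : IsFourier σ)
    (h1 : ∀ x, ‖h x‖ ≤ 1) (h2 : ∀ᶠ x in 𝓝[≠] (0 : ℝ), ‖h x‖ < 1)
    (ho : ∀ x ∈ Λ, ∀ y ∈ Λ, x ≠ y → σ (x - y) = 0) : False := by
  obtain ⟨⟨l, hl⟩, -, N, hN, hP⟩ := hΛ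
  have h3 : ∀ᶠ x in 𝓝[≠] (0 : ℝ), σ x ≠ 0 := by
    apply eventually_nhdsWithin_of_eventually_nhds
    apply hσ.continuous.continuousAt.eventually_ne
    rw [hσ.zero]; exact one_ne_zero
  obtain ⟨ε, hε, hball⟩ := Metric.eventually_nhds_iff.1 (eventually_nhdsWithin_iff.1 (h2.and h3))
  -- A countable `N` cannot swallow an interval, so Parseval is available at some `ξ ≠ l` as close
  -- to `l` as needed.
  have h4 : ¬ (Set.Ioo l (l + ε) ⊆ N) := fun hs => by
    have := (hN.mono hs).measure_zero volume
    rw [Real.volume_Ioo, ENNReal.ofReal_eq_zero] at this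
    linarith
  obtain ⟨ξ, hξ, hξN⟩ := Set.not_subset.1 h4
  obtain ⟨h5, h6⟩ := hball (y := ξ - l)
    (by rw [Real.dist_eq, sub_zero, abs_of_pos (by linarith [hξ.1])]; linarith [hξ.2])
    (by simpa using (sub_pos.2 hξ.1).ne')
  have hS := hσ.summable_sq ho ξ
  have hsum := hP ξ hξN
  -- The Parseval sum is `1` and is dominated termwise by the Bessel sum of `σ`, strictly at `l`; so
  -- the latter exceeds `1`.
  have hlt := Summable.tsum_lt_tsum (i := (⟨l, hl⟩ : Λ)) (f := fun l : Λ => ‖φ (ξ - l)‖ ^ 2)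
    (g := fun l : Λ => ‖σ (ξ - l)‖ ^ 2) (fun k => ?_) ?_ hsum.summable hS.1
  · rw [hsum.tsum_eq] at hlt
    linarith [hS.2]
  · dsimp only
    rw [hφ, norm_mul]
    gcongr
    exact mul_le_of_le_one_left (norm_nonneg _) (h1 _)
  · dsimp only
    rw [hφ, norm_mul]
    gcongr
    exact mul_lt_of_lt_one_left (norm_pos_iff.2 h6) h5

/-- Splitting off a periodic factor: if the differences between distinct classes modulo `L`
are zeros of the factor `f`, then each class is an almost spectrum of the other factor. -/
theorem IsAlmostSpectrum.split {φ f ψ : ℝ → ℂ} {Λ : Set ℝ} {L : ℝ}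
    (hΛ : IsAlmostSpectrum φ Λ) (hφ : ∀ x, φ x = f x * ψ x) (hf : IsFourier f)
    (hψ : IsFourier ψ) (hL : L ≠ 0) (hper : ∀ (x : ℝ) (n : ℤ), ‖f (x + L * n)‖ = ‖f x‖)
    (hzero : {x | f x = 0}.Countable)
    (hcross : ∀ x ∈ Λ, ∀ y ∈ Λ, (¬ ∃ n : ℤ, x - y = L * n) → f (x - y) = 0) :
    ∃ Λ' ⊆ Λ, IsAlmostSpectrum ψ Λ' ∧ ∀ x ∈ Λ', ∀ y ∈ Λ', ∃ n : ℤ, x - y = L * n := by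
  classical
  obtain ⟨⟨a, ha⟩, hort, N, hN, hP⟩ := hΛ
  set Λ' : Set ℝ := {x ∈ Λ | ∃ n : ℤ, x - a = L * n} with hΛ'
  have hsub : Λ' ⊆ Λ := fun x hx => hx.1
  have hdiff : ∀ x ∈ Λ', ∀ y ∈ Λ', ∃ n : ℤ, x - y = L * n := by
    rintro x ⟨-, n, hn⟩ y ⟨-, m, hm⟩
    exact ⟨n - m, by push_cast; linear_combination hn - hm⟩
  -- Since `f 0 = 1`, periodicity gives modulus `1` on `L ℤ`: within a class, orthogonality can only
  -- come from `ψ`.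
  have hfL : ∀ n : ℤ, f (L * n) ≠ 0 := fun n => by
    rw [← norm_ne_zero_iff, ← zero_add (L * n), hper, hf.zero]; simp
  have hort' : ∀ x ∈ Λ', ∀ y ∈ Λ', x ≠ y → ψ (x - y) = 0 := by
    intro x hx y hy hxy
    have h0 := hort x hx.1 y hy.1 hxy
    rw [hφ] at h0
    obtain ⟨n, hn⟩ := hdiff x hx y hy
    refine (mul_eq_zero.1 h0).resolve_left ?_
    rw [hn]; exact hfL n
  refine ⟨Λ', hsub, ⟨⟨a, ha, 0, by simp⟩, hort', N ∪ (fun x => x + a) '' {x | f x = 0},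
    hN.union (hzero.image _), fun ξ hξ => ?_⟩, hdiff⟩
  simp only [Set.mem_union, not_or] at hξ
  have hfa : f (ξ - a) ≠ 0 := fun h0 => hξ.2 ⟨ξ - a, h0, by ring⟩
  have hsum := hP ξ hξ.1
  obtain ⟨hS, hle⟩ := hψ.summable_sq hort' ξ
  refine hS.hasSum_iff.2 (le_antisymm hle ?_)
  -- representatives of the classes
  set r : ℝ → ℝ := fun x => L * Int.fract (x / L) with hr
  have hrx : ∀ x, ∃ n : ℤ, x = r x + L * n := fun x =>
    ⟨⌊x / L⌋, by
      simp only [hr]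
      rw [← mul_add, Int.fract_add_floor, mul_div_cancel₀ _ hL]⟩
  have hreq : ∀ x y, r x = r y ↔ ∃ n : ℤ, x - y = L * n := by
    intro x y
    simp only [hr]
    rw [mul_right_inj' hL, Int.fract_eq_fract]
    refine exists_congr fun n => ?_
    rw [← sub_div, div_eq_iff hL, mul_comm]
  have hfr : ∀ x, ‖f (ξ - x)‖ = ‖f (ξ - r x)‖ := by
    intro x
    obtain ⟨n, hn⟩ := hrx x
    rw [← hper (ξ - x) n]
    congr 2
    linear_combination -hn
  have hfrr : ∀ x ∈ Λ, ∀ y ∈ Λ, r x ≠ r y → f (r x - r y) = 0 := by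
    intro x hx y hy hxy
    have h0 := hcross x hx y hy (fun h => hxy ((hreq x y).2 h))
    obtain ⟨n, hn⟩ := hrx x
    obtain ⟨m, hm⟩ := hrx y
    rw [← norm_eq_zero, ← hper _ (n - m), norm_eq_zero, ← h0]
    congr 1
    push_cast
    linear_combination hm - hn
  set w := ‖f (ξ - a)‖ ^ 2 with hw
  have hwpos : 0 < w := by positivity
  set T := ∑' l : Λ', ‖ψ (ξ - l)‖ ^ 2 with hT
  -- Group the sum by classes. The class of `a` contributes at most `w * T`; Bessel for `ψ` in each
  -- other class, then Bessel for `f` over the representatives, bounds the rest by `1 - w`. As the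
  -- full sum is `1` and `w > 0`, this yields `T ≥ 1`.
  suffices hfin : ∀ s : Finset Λ, ∑ l ∈ s, ‖φ (ξ - l)‖ ^ 2 ≤ 1 - w + w * T by
    have : (1 : ℝ) ≤ 1 - w + w * T := by
      rw [← hsum.tsum_eq]
      nth_rewrite 2 [hsum.tsum_eq]
      exact Real.tsum_le_of_sum_le (fun _ => by positivity) hfin
    nlinarith
  intro s
  set S : Finset ℝ := s.map (Function.Embedding.subtype _) with hSdef
  have hSΛ : ∀ x ∈ S, x ∈ Λ := by
    intro x hx
    simp only [hSdef, Finset.mem_map, Function.Embedding.subtype_apply] at hx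
    obtain ⟨b, -, rfl⟩ := hx
    exact b.2
  have e1 : ∑ l ∈ s, ‖φ (ξ - l)‖ ^ 2 = ∑ x ∈ S, ‖φ (ξ - x)‖ ^ 2 := by simp [hSdef]
  rw [e1]
  have hclass : ∀ c ∈ insert (r a) (S.image r),
      ∑ x ∈ S with r x = c, ‖φ (ξ - x)‖ ^ 2
        = ‖f (ξ - c)‖ ^ 2 * ∑ x ∈ S with r x = c, ‖ψ (ξ - x)‖ ^ 2 := by
    intro c _
    rw [Finset.mul_sum]
    refine Finset.sum_congr rfl fun x hx => ?_
    rw [hφ, norm_mul, mul_pow, hfr x, (Finset.mem_filter.1 hx).2]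
  have hψle : ∀ c, ∑ x ∈ S with r x = c, ‖ψ (ξ - x)‖ ^ 2 ≤ 1 := by
    intro c
    refine hψ.sum_sq_le _ (fun x hx y hy hxy => ?_) ξ
    rw [Finset.mem_filter] at hx hy
    have h0 := hort x (hSΛ x hx.1) y (hSΛ y hy.1) hxy
    rw [hφ] at h0
    refine (mul_eq_zero.1 h0).resolve_left ?_
    obtain ⟨n, hn⟩ := (hreq x y).1 (hx.2.trans hy.2.symm)
    rw [hn]; exact hfL n
  have hψa : ∑ x ∈ S with r x = r a, ‖ψ (ξ - x)‖ ^ 2 ≤ T := by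
    have hmem : ∀ x ∈ S.filter (fun x => r x = r a), x ∈ Λ' := fun x hx => by
      rw [Finset.mem_filter] at hx
      exact ⟨hSΛ x hx.1, (hreq x a).1 hx.2⟩
    rw [← Finset.sum_subtype_of_mem (fun x => ‖ψ (ξ - x)‖ ^ 2) hmem]
    exact hS.sum_le_tsum _ fun _ _ => by positivity
  have hBessel : ∑ c ∈ insert (r a) (S.image r), ‖f (ξ - c)‖ ^ 2 ≤ 1 := by
    refine hf.sum_sq_le _ (fun x hx y hy hxy => ?_) ξ
    have hrep : ∀ z ∈ insert (r a) (S.image r), ∃ u ∈ Λ, r u = z := by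
      intro z hz
      rcases Finset.mem_insert.1 hz with rfl | hz
      · exact ⟨a, ha, rfl⟩
      · obtain ⟨u, hu, rfl⟩ := Finset.mem_image.1 hz
        exact ⟨u, hSΛ u hu, rfl⟩
    obtain ⟨u, hu, rfl⟩ := hrep x hx
    obtain ⟨v, hv, rfl⟩ := hrep y hy
    exact hfrr u hu v hv hxy
  rw [← Finset.sum_fiberwise_of_maps_to (t := insert (r a) (S.image r)) (g := r)
    (fun x hx => Finset.mem_insert_of_mem (Finset.mem_image_of_mem r hx)),
    Finset.sum_congr rfl hclass]
  have hmem : r a ∈ insert (r a) (S.image r) := Finset.mem_insert_self _ _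
  rw [← Finset.add_sum_erase _ _ hmem] at hBessel ⊢
  rw [← hfr a] at hBessel ⊢
  have h7 : ∑ c ∈ (insert (r a) (S.image r)).erase (r a),
      ‖f (ξ - c)‖ ^ 2 * ∑ x ∈ S with r x = c, ‖ψ (ξ - x)‖ ^ 2
      ≤ ∑ c ∈ (insert (r a) (S.image r)).erase (r a), ‖f (ξ - c)‖ ^ 2 :=
    Finset.sum_le_sum fun c _ => mul_le_of_le_one_right (by positivity) (hψle c)
  have h8 : w * ∑ x ∈ S with r x = r a, ‖ψ (ξ - x)‖ ^ 2 ≤ w * T := by gcongr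
  linarith

/-! ### Means of consecutive digits: factorisation, zeros and bounds. -/

/-- The Fourier transform `(1/n) ∑_{j < n} exp (2 π i j x)` of the uniform measure
on `{0, …, n - 1}`. -/
noncomputable def digitMean (n : ℕ) (x : ℝ) : ℂ :=
  (n : ℂ)⁻¹ * ∑ j ∈ Finset.range n, expo 1 (j * x)

theorem fourierAt_uniformOnDigits {s : ℝ} (hs : s ≠ 0) (n : ℕ) (ξ : ℝ) :
    fourierAt (uniformOnDigits (scaledDigits s n)) ξ = digitMean n (s⁻¹ * ξ) := by
  have hinj : Function.Injective fun j : ℕ => s⁻¹ * (j : ℝ) := fun i j h => by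
    have := mul_left_cancel₀ (inv_ne_zero hs) h
    exact_mod_cast this
  rw [fourierAt_eq, uniformOnDigits, integral_smul_measure, integral_finsetSum_measure]
  · simp only [integral_dirac, scaledDigits, Finset.card_image_of_injective _ hinj,
      Finset.card_range]
    rw [Finset.sum_image fun _ _ _ _ h => hinj h, digitMean]
    simp only [ENNReal.toReal_inv, ENNReal.toReal_natCast, Complex.real_smul, Complex.ofReal_inv,
      Complex.ofReal_natCast]
    congr 1
    refine Finset.sum_congr rfl fun j _ => ?_
    unfold expo; congr 1; push_cast; ring
  · intro a _
    exact integrable_dirac (by simp [enorm_eq_nnnorm])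

theorem scaledDigits_nonempty (s : ℝ) {n : ℕ} (hn : 1 ≤ n) : (scaledDigits s n).Nonempty := by
  rw [scaledDigits, Finset.image_nonempty, Finset.nonempty_range_iff]
  omega

theorem isFourier_digitMean {n : ℕ} (hn : 1 ≤ n) {t : ℝ} (ht : t ≠ 0) :
    IsFourier fun x => digitMean n (t * x) :=
  ⟨uniformOnDigits (scaledDigits t⁻¹ n),
    isProbabilityMeasure_uniformOnDigits _ (scaledDigits_nonempty _ hn), fun ξ => by
      rw [fourierAt_uniformOnDigits (inv_ne_zero ht), inv_inv]⟩

/-- Each `j < d * e` is uniquely `i + d * k` with `i < d`, `k < e`. This isolates the pieces later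
shown to be redundant. -/
theorem digitMean_mul (d e : ℕ) (x : ℝ) :
    digitMean (d * e) x = digitMean d x * digitMean e (d * x) := by
  have h : ∑ j ∈ Finset.range (d * e), expo 1 (j * x)
      = (∑ j ∈ Finset.range d, expo 1 (j * x)) * ∑ j ∈ Finset.range e, expo 1 (j * (d * x)) := by
    simp only [expo_one_natCast_mul]
    induction e with
    | zero => simp
    | succ e ih =>
      rw [Nat.mul_succ, Finset.sum_range_add, ih, Finset.sum_range_succ, mul_add]
      congr 1
      rw [Finset.sum_mul]
      refine Finset.sum_congr rfl fun j _ => ?_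
      rw [pow_add, pow_mul, mul_comm]
  rw [digitMean, digitMean, digitMean, h]
  push_cast
  rw [mul_inv]
  ring

theorem digitMean_add_int (n : ℕ) (x : ℝ) (k : ℤ) : digitMean n (x + k) = digitMean n x := by
  have : expo 1 (x + k) = expo 1 x := by
    have h : expo 1 (k : ℝ) = 1 := (expo_one_eq_one_iff _).2 ⟨k, rfl⟩
    rw [show expo 1 (x + k) = expo 1 x * expo 1 (k : ℝ) by
      unfold expo; rw [← Complex.exp_add]; congr 1; push_cast; ring, h, mul_one]
  simp only [digitMean, expo_one_natCast_mul, this]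

theorem digitMean_eq_zero_iff {n : ℕ} (hn : 1 ≤ n) (x : ℝ) :
    digitMean n x = 0 ↔ (∃ j : ℤ, n * x = j) ∧ ¬ ∃ j : ℤ, x = j := by
  have hn0 : (n : ℂ) ≠ 0 := by exact_mod_cast (by omega : n ≠ 0)
  rw [← expo_one_eq_one_iff, ← expo_one_eq_one_iff, expo_one_natCast_mul, digitMean]
  simp only [expo_one_natCast_mul]
  by_cases h : expo 1 x = 1
  · simp [h, hn0]
  · rw [geom_sum_eq h]
    simp [h, hn0, sub_eq_zero]

theorem norm_digitMean_le (n : ℕ) (x : ℝ) : ‖digitMean n x‖ ≤ 1 := by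
  rw [digitMean, norm_mul, norm_inv, Complex.norm_natCast]
  have : ‖∑ j ∈ Finset.range n, expo 1 (j * x)‖ ≤ n := by
    refine (norm_sum_le _ _).trans ?_
    simp [norm_expo]
  rcases Nat.eq_zero_or_pos n with rfl | hn
  · simp
  · rw [inv_mul_le_iff₀ (by positivity)]
    linarith

/-- The first two summands are distinct unit vectors, so the triangle inequality is already strict
for them. -/
theorem norm_digitMean_lt {n : ℕ} (hn : 2 ≤ n) {x : ℝ} (hx : ¬ ∃ j : ℤ, x = j) :
    ‖digitMean n x‖ < 1 := by
  obtain ⟨m, rfl⟩ : ∃ m, n = m + 2 := ⟨n - 2, by omega⟩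
  have hz := norm_expo 1 x
  rw [← expo_one_eq_one_iff] at hx
  have h2 : ‖1 + expo 1 x‖ < 2 := by
    have h := (not_sameRay_iff_norm_add_lt (x := (1 : ℂ)) (y := expo 1 x)).1 ?_
    · rw [hz, norm_one] at h; linarith
    · intro hs
      exact hx ((sameRay_iff_of_norm_eq (by simp [hz])).1 hs).symm
  rw [digitMean, norm_mul, norm_inv, Complex.norm_natCast, inv_mul_lt_iff₀ (by positivity),
    Finset.sum_range_succ', Finset.sum_range_succ']
  have h3 : ‖∑ j ∈ Finset.range m, expo 1 (((j + 1 + 1 : ℕ) : ℝ) * x)‖ ≤ m := by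
    refine (norm_sum_le _ _).trans ?_
    simp [norm_expo]
  have h4 : expo 1 (((0 : ℕ) : ℝ) * x) = 1 := by simp [expo]
  have h5 : expo 1 (((0 + 1 : ℕ) : ℝ) * x) = expo 1 x := by simp
  rw [h4, h5, add_assoc, add_comm (expo 1 x) 1]
  have := norm_add_le (∑ j ∈ Finset.range m, expo 1 (((j + 1 + 1 : ℕ) : ℝ) * x)) (1 + expo 1 x)
  push_cast at *
  linarith

theorem eventually_norm_digitMean_lt {n : ℕ} (hn : 2 ≤ n) {t : ℝ} (ht : t ≠ 0) :
    ∀ᶠ x in 𝓝[≠] (0 : ℝ), ‖digitMean n (t * x)‖ < 1 := by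
  rw [eventually_nhdsWithin_iff, Metric.eventually_nhds_iff]
  refine ⟨|t|⁻¹, by positivity, fun x hx hx0 => norm_digitMean_lt hn ?_⟩
  rintro ⟨j, hj⟩
  rw [Real.dist_eq, sub_zero, ← one_div, lt_div_iff₀ (by positivity), mul_comm, ← abs_mul, hj] at hx
  have : j = 0 := by
    rw [← Int.abs_lt_one_iff]; exact_mod_cast hx
  rw [this, Int.cast_zero] at hj
  exact (mul_ne_zero ht hx0) hj

theorem norm_digitMean_sub_one_le {n : ℕ} (hn : 1 ≤ n) (x : ℝ) :
    ‖digitMean n x - 1‖ ≤ 2 * Real.pi * |x| * (n - 1) := by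
  have hn0 : (n : ℂ) ≠ 0 := by exact_mod_cast (by omega : n ≠ 0)
  have e : digitMean n x - 1 = (n : ℂ)⁻¹ * ∑ j ∈ Finset.range n, (expo 1 (j * x) - 1) := by
    rw [Finset.sum_sub_distrib, mul_sub, digitMean]
    simp [hn0]
  have hnr : (0 : ℝ) < n := by exact_mod_cast hn
  rw [e, norm_mul, norm_inv, Complex.norm_natCast, inv_mul_le_iff₀ hnr]
  refine (norm_sum_le _ _).trans ?_
  have : ∀ j ∈ Finset.range n, ‖expo 1 (j * x) - 1‖ ≤ 2 * Real.pi * |x| * (n - 1) := by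
    intro j hj
    have hj' : (j : ℝ) + 1 ≤ n := by exact_mod_cast Finset.mem_range.1 hj
    rw [expo_eq, mul_comm _ Complex.I]
    refine (Real.norm_exp_I_mul_ofReal_sub_one_le).trans ?_
    rw [Real.norm_eq_abs, abs_mul, abs_of_pos (by positivity : 0 < 2 * Real.pi), one_mul, abs_mul,
      Nat.abs_cast]
    have := mul_le_mul_of_nonneg_left (by linarith : (j : ℝ) ≤ n - 1)
      (by positivity : 0 ≤ 2 * Real.pi * |x|)
    linarith
  refine (Finset.sum_le_sum this).trans ?_
  simp

theorem countable_digitMean_eq_zero {n : ℕ} (hn : 1 ≤ n) {t : ℝ} (ht : t ≠ 0) :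
    {x | digitMean n (t * x) = 0}.Countable := by
  refine (Set.countable_range fun j : ℤ => t⁻¹ * ((n : ℝ)⁻¹ * j)).mono ?_
  intro x hx
  obtain ⟨⟨j, hj⟩, -⟩ := (digitMean_eq_zero_iff hn _).1 hx
  have : (n : ℝ) ≠ 0 := by exact_mod_cast (by omega : n ≠ 0)
  exact ⟨j, by simp only [← hj]; field_simp⟩

/-! ### The infinite product and its tails. -/

/-- The Fourier transform of `factor b p i`. -/
noncomputable def factorHat (b p : ℕ → ℕ) (i : ℕ) (ξ : ℝ) : ℂ :=
  digitMean (digitCount p i) ((scale b p i)⁻¹ * ξ)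

/-- The Fourier transform of the convolution of the factors with index greater than `n`. -/
noncomputable def tailHat (b p : ℕ → ℕ) (n : ℕ) (ξ : ℝ) : ℂ :=
  ∏' i, factorHat b p (n + 1 + i) ξ

theorem one_le_digitCount {p : ℕ → ℕ} (hp_pos : ∀ k, 1 ≤ k → 1 ≤ p k) {n : ℕ} (hn : 1 ≤ n) :
    1 ≤ digitCount p n := by
  unfold digitCount
  split_ifs
  · exact hp_pos n hn
  · norm_num
  · exact hp_pos _ (by omega)

/-- Weak convergence implies pointwise convergence of characteristic functions, and convolution
becomes multiplication. -/
theorem tendsto_fourierAt_of_isInfiniteConvolution {μ : ℕ → Measure ℝ}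
    [∀ i, IsProbabilityMeasure (μ (i + 1))] {ν : Measure ℝ} [IsProbabilityMeasure ν]
    (h : IsInfiniteConvolution μ ν) (ξ : ℝ) :
    Tendsto (fun n => ∏ i ∈ Finset.range n, fourierAt (μ (i + 1)) ξ) atTop
      (𝓝 (fourierAt ν ξ)) := by
  have hP : ∀ n, IsProbabilityMeasure (partialConv μ n) := by
    intro n
    induction n with
    | zero => exact Measure.dirac.isProbabilityMeasure
    | succ n ih => rw [partialConv]; infer_instance
  let P : ℕ → ProbabilityMeasure ℝ := fun n => ⟨partialConv μ n, hP n⟩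
  let Q : ProbabilityMeasure ℝ := ⟨ν, inferInstance⟩
  have h1 : Tendsto P atTop (𝓝 Q) :=
    ProbabilityMeasure.tendsto_iff_forall_integral_tendsto.2 h
  have h2 := ProbabilityMeasure.tendsto_iff_tendsto_charFun.1 h1 (2 * Real.pi * ξ)
  refine h2.congr fun n => ?_
  change fourierAt (partialConv μ n) ξ = _
  induction n with
  | zero => simp [partialConv, fourierAt, charFun_apply]
  | succ n ih =>
    have := hP n
    rw [Finset.prod_range_succ, ← ih, partialConv]
    simp only [fourierAt, charFun_conv]

section Tail

variable {b p : ℕ → ℕ}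

theorem isProbabilityMeasure_factor (hp_pos : ∀ k, 1 ≤ k → 1 ≤ p k) {i : ℕ} (hi : 1 ≤ i) :
    IsProbabilityMeasure (factor b p i) :=
  isProbabilityMeasure_uniformOnDigits _ (scaledDigits_nonempty _ (one_le_digitCount hp_pos hi))

theorem fourierAt_factor (hp_pos : ∀ k, 1 ≤ k → 1 ≤ p k) (hbp : ∀ k, 1 ≤ k → 2 * p k ≤ b k)
    {i : ℕ} (hi : 1 ≤ i) (ξ : ℝ) : fourierAt (factor b p i) ξ = factorHat b p i ξ :=
  fourierAt_uniformOnDigits (digit_bound b p hp_pos hbp i hi).1.ne' _ _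

theorem isFourier_factorHat (hp_pos : ∀ k, 1 ≤ k → 1 ≤ p k) (hbp : ∀ k, 1 ≤ k → 2 * p k ≤ b k)
    {i : ℕ} (hi : 1 ≤ i) : IsFourier (factorHat b p i) :=
  isFourier_digitMean (one_le_digitCount hp_pos hi)
    (inv_ne_zero (digit_bound b p hp_pos hbp i hi).1.ne')

theorem summable_half_pow : Summable fun n : ℕ => 2 * (1 / 2 : ℝ) ^ (n / 2) := by
  apply Summable.mul_left
  have h1 : Summable fun k : ℕ => (1 / 2 : ℝ) ^ (2 * k / 2) := by
    simpa using summable_geometric_two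
  have h2 : Summable fun k : ℕ => (1 / 2 : ℝ) ^ ((2 * k + 1) / 2) := by
    have : ∀ k : ℕ, (2 * k + 1) / 2 = k := fun k => by omega
    simpa only [this] using summable_geometric_two
  exact h1.even_add_odd h2

theorem summable_norm_factorHat_sub_one (hp_pos : ∀ k, 1 ≤ k → 1 ≤ p k)
    (hbp : ∀ k, 1 ≤ k → 2 * p k ≤ b k) (n : ℕ) (ξ : ℝ) :
    Summable fun i => ‖factorHat b p (n + 1 + i) ξ - 1‖ := by
  have hs := ((summable_nat_add_iff (n + 1)).2 summable_half_pow).mul_left (2 * Real.pi * |ξ|)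
  refine Summable.of_nonneg_of_le (fun _ => norm_nonneg _) (fun i => ?_) hs
  obtain ⟨h1, h2⟩ := digit_bound b p hp_pos hbp (n + 1 + i) (by omega)
  refine (norm_digitMean_sub_one_le (one_le_digitCount hp_pos (by omega)) _).trans ?_
  rw [abs_mul, abs_of_pos (inv_pos.2 h1), add_comm i]
  calc 2 * Real.pi * ((scale b p (n + 1 + i))⁻¹ * |ξ|) * ((digitCount p (n + 1 + i) : ℝ) - 1)
      = 2 * Real.pi * |ξ| *
        ((scale b p (n + 1 + i))⁻¹ * ((digitCount p (n + 1 + i) : ℝ) - 1)) := by ring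
    _ ≤ _ := by gcongr

theorem multipliable_factorHat (hp_pos : ∀ k, 1 ≤ k → 1 ≤ p k)
    (hbp : ∀ k, 1 ≤ k → 2 * p k ≤ b k) (n : ℕ) (ξ : ℝ) :
    Multipliable fun i => factorHat b p (n + 1 + i) ξ := by
  have := multipliable_one_add_of_summable (summable_norm_factorHat_sub_one hp_pos hbp n ξ)
  simpa using this

/-- The tail belongs to the infinite convolution of the shifted factors, which is what makes
Bessel's inequality available after peeling. -/
theorem isFourier_tailHat (hp_pos : ∀ k, 1 ≤ k → 1 ≤ p k) (hbp : ∀ k, 1 ≤ k → 2 * p k ≤ b k)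
    (n : ℕ) : IsFourier (tailHat b p n) := by
  have hprob : ∀ i, IsProbabilityMeasure (factor b p (n + (i + 1))) := fun i =>
    isProbabilityMeasure_factor hp_pos (by omega)
  have hs : Summable fun i : ℕ => 2 * (1 / 2 : ℝ) ^ ((i + (n + 1)) / 2) :=
    (summable_nat_add_iff (f := fun i : ℕ => 2 * (1 / 2 : ℝ) ^ (i / 2)) (n + 1)).2 summable_half_pow
  obtain ⟨τ, hτ, -, hconv⟩ := exists_infiniteConvolution (fun i => factor b p (n + i))
    (fun i => 2 * (1 / 2 : ℝ) ^ ((i + (n + 1)) / 2)) hs (fun i => by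
      filter_upwards [ae_mem_uniformOnDigits
        (scaledDigits (scale b p (n + (i + 1))) (digitCount p (n + (i + 1))))] with x hx
      simp only [scaledDigits, Finset.mem_image, Finset.mem_range] at hx
      obtain ⟨j, hj, rfl⟩ := hx
      obtain ⟨h1, h2⟩ := digit_bound b p hp_pos hbp (n + (i + 1)) (by omega)
      rw [show i + (n + 1) = n + (i + 1) by ring]
      refine ⟨by positivity, le_trans ?_ h2⟩
      have : (j : ℝ) + 1 ≤ digitCount p (n + (i + 1)) := by exact_mod_cast hj
      have : (j : ℝ) ≤ (digitCount p (n + (i + 1)) : ℝ) - 1 := by linarith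
      gcongr)
  refine ⟨τ, hτ, fun ξ => ?_⟩
  have h1 := tendsto_fourierAt_of_isInfiniteConvolution hconv ξ
  have h2 : ∀ i, fourierAt (factor b p (n + (i + 1))) ξ = factorHat b p (n + 1 + i) ξ := fun i => by
    rw [fourierAt_factor hp_pos hbp (by omega), show n + (i + 1) = n + 1 + i by ring]
  simp only [h2] at h1
  exact tendsto_nhds_unique (multipliable_factorHat hp_pos hbp n ξ).hasProd.tendsto_prod_nat h1

theorem fourierAt_eq_tailHat (hp_pos : ∀ k, 1 ≤ k → 1 ≤ p k) (hbp : ∀ k, 1 ≤ k → 2 * p k ≤ b k)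
    {ν : Measure ℝ} [IsProbabilityMeasure ν] (hν : IsInfiniteConvolution (factor b p) ν) :
    fourierAt ν = tailHat b p 0 := by
  ext ξ
  have hprob : ∀ i, IsProbabilityMeasure (factor b p (i + 1)) := fun i =>
    isProbabilityMeasure_factor hp_pos (by omega)
  refine tendsto_nhds_unique (tendsto_fourierAt_of_isInfiniteConvolution hν ξ) ?_
  refine (multipliable_factorHat hp_pos hbp 0 ξ).hasProd.tendsto_prod_nat.congr fun m => ?_
  refine Finset.prod_congr rfl fun i _ => ?_
  rw [fourierAt_factor hp_pos hbp (by omega), show 0 + 1 + i = i + 1 by ring]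

theorem tailHat_eq_mul (hp_pos : ∀ k, 1 ≤ k → 1 ≤ p k) (hbp : ∀ k, 1 ≤ k → 2 * p k ≤ b k)
    (n : ℕ) (ξ : ℝ) : tailHat b p n ξ = factorHat b p (n + 1) ξ * tailHat b p (n + 1) ξ := by
  have e : (fun i => factorHat b p (n + 1 + (i + 1)) ξ) = fun i => factorHat b p (n + 1 + 1 + i) ξ :=
    funext fun i => by rw [show n + 1 + (i + 1) = n + 1 + 1 + i by ring]
  have h := tprod_eq_zero_mul' (f := fun i => factorHat b p (n + 1 + i) ξ)
    (e ▸ multipliable_factorHat hp_pos hbp (n + 1) ξ)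
  rw [e] at h
  exact h

theorem tailHat_zero_eq_prod_mul (hp_pos : ∀ k, 1 ≤ k → 1 ≤ p k)
    (hbp : ∀ k, 1 ≤ k → 2 * p k ≤ b k) (n : ℕ) (ξ : ℝ) :
    tailHat b p 0 ξ = (∏ i ∈ Finset.Icc 1 n, factorHat b p i ξ) * tailHat b p n ξ := by
  induction n with
  | zero => simp
  | succ n ih =>
    rw [ih, tailHat_eq_mul hp_pos hbp, Finset.prod_Icc_succ_top (by omega), mul_assoc]

/-- An infinite product with summable deviations from `1` vanishes only through one of its factors.
-/
theorem exists_factorHat_eq_zero (hp_pos : ∀ k, 1 ≤ k → 1 ≤ p k)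
    (hbp : ∀ k, 1 ≤ k → 2 * p k ≤ b k) {n : ℕ} {ξ : ℝ} (h : tailHat b p n ξ = 0) :
    ∃ i, n < i ∧ factorHat b p i ξ = 0 := by
  by_contra! hne
  have := tprod_one_add_ne_zero_of_summable (f := fun i => factorHat b p (n + 1 + i) ξ - 1)
    (fun i => by simpa using hne _ (by omega)) (summable_norm_factorHat_sub_one hp_pos hbp n ξ)
  refine this ?_
  simp only [add_sub_cancel]
  exact h

end Tail

/-! ### Two-adic integrality and peeling off digits. -/

/-- The real numbers that are quotients of an integer by an odd integer. -/
def oddLocal : AddSubgroup ℝ where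
  carrier := {x | ∃ m : ℤ, Odd m ∧ ∃ n : ℤ, m * x = n}
  zero_mem' := ⟨1, odd_one, 0, by simp⟩
  add_mem' := by
    rintro x y ⟨m, hm, n, hn⟩ ⟨m', hm', n', hn'⟩
    exact ⟨m * m', hm.mul hm', m' * n + m * n', by
      push_cast; rw [← hn, ← hn']; ring⟩
  neg_mem' := by
    rintro x ⟨m, hm, n, hn⟩
    exact ⟨m, hm, -n, by push_cast; rw [← hn]; ring⟩

/-- An odd denominator cannot cancel a `2`. Hence the zeros of `digitMean 2`, the half-odd integers,
all lie outside `oddLocal`. -/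
theorem exists_int_of_two_mul {x : ℝ} (hx : x ∈ oddLocal) {j : ℤ} (h : 2 * x = j) :
    ∃ n : ℤ, x = n := by
  obtain ⟨m, hm, n, hn⟩ := hx
  have h1 : m * j = 2 * n := by
    have : (m : ℝ) * j = 2 * n := by rw [← h, ← hn]; ring
    exact_mod_cast this
  have h2 : Even (m * j) := ⟨n, by rw [h1]; ring⟩
  rw [Int.even_mul] at h2
  obtain ⟨i, hi⟩ := h2.resolve_left (Int.not_even_iff_odd.2 hm)
  exact ⟨i, by rw [hi] at h; push_cast at h; linarith⟩

/-- Redundancy need only be tested where the digit mean vanishes. It may hold because the mean never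
vanishes on differences, or because the other factors vanish there too; both cases occur below. -/
theorem IsAlmostSpectrum.false_of_digitMean_factor {φ σ : ℝ → ℂ} {Λ : Set ℝ} {e : ℕ} {t : ℝ}
    (hΛ : IsAlmostSpectrum φ Λ) (he : 2 ≤ e) (ht : t ≠ 0)
    (hφ : ∀ x, φ x = digitMean e (t * x) * σ x) (hσ : IsFourier σ)
    (ho : ∀ x ∈ Λ, ∀ y ∈ Λ, digitMean e (t * (x - y)) = 0 → σ (x - y) = 0) : False :=
  hΛ.false_of_factor hφ hσ (fun _ => norm_digitMean_le _ _) (eventually_norm_digitMean_lt he ht)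
    fun x hx y hy hxy => by
      have h := hΛ.orth x hx y hy hxy
      rw [hφ, mul_eq_zero] at h
      exact h.elim (ho x hx y hy) id

/-- If an almost spectrum is contained in a coset of `L ℤ`, then the number of digits at the scale
`L c` divides `c`. -/
theorem IsAlmostSpectrum.dvd {φ T : ℝ → ℂ} {Λ : Set ℝ} {n c : ℕ} {B L : ℝ}
    (hΛ : IsAlmostSpectrum φ Λ) (hn : 1 ≤ n) (hL : L ≠ 0) (hc : c ≠ 0) (hB : B = L * c)
    (hφ : ∀ x, φ x = digitMean n (B⁻¹ * x) * T x) (hT : IsFourier T)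
    (hdiff : ∀ x ∈ Λ, ∀ y ∈ Λ, ∃ k : ℤ, x - y = L * k) : n ∣ c := by
  by_contra hnc
  obtain ⟨g, e, c', hg, hcop, rfl, rfl⟩ := Nat.exists_coprime' (Nat.gcd_pos_of_pos_left c hn)
  have he0 : e ≠ 0 := by rintro rfl; simp at hn
  have he1 : e ≠ 1 := by rintro rfl; simp at hnc
  have hc0 : (c' : ℝ) ≠ 0 := by
    have : c' ≠ 0 := by rintro rfl; simp at hc
    exact_mod_cast this
  have hg0 : (g : ℝ) ≠ 0 := by exact_mod_cast hg.ne'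
  push_cast at hB
  have hB0 : B⁻¹ ≠ 0 := by rw [hB]; positivity
  -- With `g` the gcd, split `n = g * e` and `c = g * c'`. On differences the argument of the
  -- `e`-digit piece is `k / c'`; a zero would make `e * k / c'` an integer, so `c' ∣ k` by
  -- coprimality, and the argument would be an integer, where the mean is nonzero.
  refine hΛ.false_of_digitMean_factor (e := e) (t := g * B⁻¹)
    (σ := fun x => digitMean g (B⁻¹ * x) * T x) (by omega) (mul_ne_zero hg0 hB0) (fun x => ?_)
    ((isFourier_digitMean hg hB0).mul hT) fun x hx y hy h => ?_
  · rw [hφ, mul_comm e g, digitMean_mul, ← mul_assoc (g : ℝ)]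
    ring
  · exfalso
    obtain ⟨k, hk⟩ := hdiff x hx y hy
    have hval : g * B⁻¹ * (x - y) = k / c' := by rw [hk, hB]; field_simp
    rw [hval, digitMean_eq_zero_iff (by omega)] at h
    obtain ⟨⟨i, hi⟩, hni⟩ := h
    have h1 : (e : ℤ) * k = c' * i := by
      have : (e : ℝ) * k = c' * i := by rw [← hi]; field_simp
      exact_mod_cast this
    have h2 : (c' : ℤ) ∣ k :=
      IsCoprime.dvd_of_dvd_mul_left (Nat.isCoprime_iff_coprime.2 hcop.symm) ⟨i, h1⟩
    obtain ⟨j, rfl⟩ := h2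
    exact hni ⟨j, by push_cast; field_simp⟩

theorem norm_digitMean_periodic {n : ℕ} {t L : ℝ} {m : ℤ} (h : t * L = m) (x : ℝ) (k : ℤ) :
    ‖digitMean n (t * (x + L * k))‖ = ‖digitMean n (t * x)‖ := by
  rw [show t * (x + L * k) = t * x + ((m * k : ℤ) : ℝ) by
    push_cast; rw [← h]; ring, digitMean_add_int]

/-- Splitting off an even number of consecutive digits at the scale `B`, when the zeros of the
other factor have at least the same `2`-adic valuation as `B`. -/
theorem IsAlmostSpectrum.split_consecutive {φ T : ℝ → ℂ} {Λ : Set ℝ} {n : ℕ} {B : ℝ}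
    (hΛ : IsAlmostSpectrum φ Λ) (hn : 1 ≤ n) (hn2 : 2 ∣ n) (hB : B ≠ 0)
    (hφ : ∀ x, φ x = digitMean n (B⁻¹ * x) * T x) (hT : IsFourier T)
    (hTz : ∀ x, T x = 0 → B⁻¹ * x ∈ oddLocal) :
    ∃ Λ' ⊆ Λ, IsAlmostSpectrum T Λ' ∧ ∀ x ∈ Λ', ∀ y ∈ Λ', ∃ k : ℤ, x - y = B * k := by
  have hBi : B⁻¹ ≠ 0 := inv_ne_zero hB
  have hnR : (n : ℝ) ≠ 0 := by exact_mod_cast (by omega : n ≠ 0)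
  -- two elements whose difference has small valuation
  obtain ⟨u, hu, v, hv, huv⟩ : ∃ u ∈ Λ, ∃ v ∈ Λ, B⁻¹ * (u - v) ∉ oddLocal := by
    -- If all scaled differences were in `oddLocal`, none would be a half-odd integer, so the
    -- two-digit piece of the even digit block would be redundant.
    by_contra! hall
    obtain ⟨n', rfl⟩ := hn2
    refine hΛ.false_of_digitMean_factor (e := 2) (t := B⁻¹)
      (σ := fun x => digitMean n' (2 * B⁻¹ * x) * T x) le_rfl hBi (fun x => ?_)
      ((isFourier_digitMean (by omega) (by positivity)).mul hT) fun x hx y hy h => ?_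
    · rw [hφ, digitMean_mul]; push_cast; ring_nf
    · exfalso
      rw [digitMean_eq_zero_iff (by norm_num)] at h
      obtain ⟨⟨j, hj⟩, hni⟩ := h
      exact hni (exists_int_of_two_mul (hall x hx y hy) (by exact_mod_cast hj))
  have hzero : ∀ x ∈ Λ, ∀ y ∈ Λ, B⁻¹ * (x - y) ∉ oddLocal → digitMean n (B⁻¹ * (x - y)) = 0 := by
    intro x hx y hy hxy
    have h := hΛ.orth x hx y hy (fun h => hxy (by simp [h, oddLocal.zero_mem]))
    rw [hφ, mul_eq_zero] at h
    exact h.resolve_right fun h => hxy (hTz _ h)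
  have hint : ∀ x ∈ Λ, ∀ y ∈ Λ, B⁻¹ * (x - y) ∉ oddLocal → ∃ j : ℤ, n * (B⁻¹ * (x - y)) = j :=
    fun x hx y hy hxy => ((digitMean_eq_zero_iff hn _).1 (hzero x hx y hy hxy)).1
  -- Differences outside `oddLocal` are zeros of the digit mean. When `x - y` gives no such
  -- information, pass through `w ∈ {u, v}`: as `u` and `v` are in different classes modulo
  -- `oddLocal`, one of them differs from the common class of `x` and `y`.
  have hlat : ∀ x ∈ Λ, ∀ y ∈ Λ, ∃ j : ℤ, n * (B⁻¹ * (x - y)) = j := by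
    intro x hx y hy
    by_cases hxy : B⁻¹ * (x - y) ∈ oddLocal
    · obtain ⟨w, hw, hxw⟩ : ∃ w ∈ Λ, B⁻¹ * (x - w) ∉ oddLocal := by
        by_cases h : B⁻¹ * (x - u) ∈ oddLocal
        · refine ⟨v, hv, fun h' => huv ?_⟩
          rw [show B⁻¹ * (u - v) = B⁻¹ * (x - v) - B⁻¹ * (x - u) by ring]
          exact oddLocal.sub_mem h' h
        · exact ⟨u, hu, h⟩
      have hyw : B⁻¹ * (y - w) ∉ oddLocal := fun h' => hxw (by
        rw [show B⁻¹ * (x - w) = B⁻¹ * (x - y) + B⁻¹ * (y - w) by ring]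
        exact oddLocal.add_mem hxy h')
      obtain ⟨i, hi⟩ := hint x hx w hw hxw
      obtain ⟨j, hj⟩ := hint y hy w hw hyw
      exact ⟨i - j, by push_cast; rw [← hi, ← hj]; ring⟩
    · exact hint x hx y hy hxy
  refine hΛ.split (f := fun x => digitMean n (B⁻¹ * x)) hφ (isFourier_digitMean hn hBi) hT hB
    (norm_digitMean_periodic (m := 1) (by simp [hB])) (countable_digitMean_eq_zero hn hBi)
    fun x hx y hy hxy => (digitMean_eq_zero_iff hn _).2 ⟨hlat x hx y hy, ?_⟩
  rintro ⟨j, hj⟩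
  exact hxy ⟨j, by rw [← hj]; field_simp⟩

/-- Splitting off the two digits `{0, m / (2 B)}` with `m` odd from an almost spectrum contained in
a coset of `B ℤ`. -/
theorem IsAlmostSpectrum.split_pair {φ T : ℝ → ℂ} {Λ : Set ℝ} {m : ℤ} {B : ℝ}
    (hΛ : IsAlmostSpectrum φ Λ) (hm : Odd m) (hB : B ≠ 0)
    (hφ : ∀ x, φ x = digitMean 2 (m / (2 * B) * x) * T x) (hT : IsFourier T)
    (hdiff : ∀ x ∈ Λ, ∀ y ∈ Λ, ∃ k : ℤ, x - y = B * k) :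
    ∃ Λ' ⊆ Λ, IsAlmostSpectrum T Λ' ∧ ∀ x ∈ Λ', ∀ y ∈ Λ', ∃ k : ℤ, x - y = 2 * B * k := by
  have hmR : (m : ℝ) ≠ 0 := by
    have : m ≠ 0 := by rintro rfl; simp at hm
    exact_mod_cast this
  have ht : (m : ℝ) / (2 * B) ≠ 0 := by positivity
  refine hΛ.split (f := fun x => digitMean 2 (m / (2 * B) * x)) hφ
    (isFourier_digitMean (by norm_num) ht) hT (by positivity)
    (norm_digitMean_periodic (m := m) (by field_simp))
    (countable_digitMean_eq_zero (by norm_num) ht)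
    -- A difference `B * k` outside `2 * B * ℤ` has `k` odd, so the argument `m * k / 2` is a
    -- half-odd integer.
    fun x hx y hy hxy => (digitMean_eq_zero_iff (by norm_num) _).2 ?_
  obtain ⟨k, hk⟩ := hdiff x hx y hy
  have hval : m / (2 * B) * (x - y) = m * k / 2 := by rw [hk]; field_simp
  rw [hval]
  refine ⟨⟨m * k, by push_cast; ring⟩, ?_⟩
  rintro ⟨j, hj⟩
  have h1 : m * k = 2 * j := by
    have : (m : ℝ) * k = 2 * j := by linarith
    exact_mod_cast this
  have h2 : Even (m * k) := ⟨j, by rw [h1]; ring⟩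
  rw [Int.even_mul] at h2
  obtain ⟨i, hi⟩ := h2.resolve_left (Int.not_even_iff_odd.2 hm)
  exact hxy ⟨i, by rw [hk, hi]; push_cast; ring⟩

/-! ### The factors at the scales `b₁ ⋯ bₖ` and their zeros. -/

/-- The product `b₁ ⋯ bₖ`. -/
noncomputable def prodRatio (b : ℕ → ℕ) (k : ℕ) : ℝ := ∏ i ∈ Finset.Icc 1 k, (b i : ℝ)

theorem prodRatio_succ (b : ℕ → ℕ) (k : ℕ) : prodRatio b (k + 1) = prodRatio b k * b (k + 1) := by
  rw [prodRatio, prodRatio, Finset.prod_Icc_succ_top (by omega)]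

theorem exists_prodRatio_eq_mul (b : ℕ → ℕ) {k j : ℕ} (h : k ≤ j) :
    ∃ N : ℕ, prodRatio b j = prodRatio b k * N := by
  induction j, h using Nat.le_induction with
  | base => exact ⟨1, by simp⟩
  | succ j _ ih =>
    obtain ⟨N, hN⟩ := ih
    exact ⟨N * b (j + 1), by rw [prodRatio_succ, hN]; push_cast; ring⟩

section Moran

variable {b p : ℕ → ℕ}

theorem prodRatio_pos (hp_pos : ∀ k, 1 ≤ k → 1 ≤ p k) (hbp : ∀ k, 1 ≤ k → 2 * p k ≤ b k) (k : ℕ) :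
    0 < prodRatio b k :=
  lt_of_lt_of_le (by positivity) (two_pow_le_prod b p hp_pos hbp k)

theorem factorHat_even (hp_pos : ∀ k, 1 ≤ k → 1 ≤ p k) (hbp : ∀ k, 1 ≤ k → 2 * p k ≤ b k)
    {k : ℕ} (hk : 1 ≤ k) (ξ : ℝ) :
    factorHat b p (2 * k) ξ = digitMean (p (k + 1)) ((prodRatio b (k + 1))⁻¹ * ξ) := by
  have hd : digitCount p (2 * k) = p (k + 1) := by
    obtain ⟨j, rfl⟩ : ∃ j, k = j + 1 := ⟨k - 1, by omega⟩
    rcases Nat.eq_zero_or_pos j with rfl | hj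
    · exact digitCount_two p
    · exact digitCount_even p j hj
  rw [factorHat, hd, scale_even b p hp_pos hbp k hk, prodRatio]

theorem factorHat_one (ξ : ℝ) :
    factorHat b p 1 ξ = digitMean (p 1) ((prodRatio b 1)⁻¹ * ξ) := by
  rw [factorHat, digitCount_one]
  simp [scale, prodRatio, ratio_one]

/-- The integer `bₖ₊₁ (2 pₖ - 1) - 1`. -/
def pairNum (b p : ℕ → ℕ) (k : ℕ) : ℤ := b (k + 1) * (2 * p k - 1) - 1

theorem factorHat_odd (hp_pos : ∀ k, 1 ≤ k → 1 ≤ p k) (hbp : ∀ k, 1 ≤ k → 2 * p k ≤ b k)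
    {k : ℕ} (hk : 1 ≤ k) (ξ : ℝ) :
    factorHat b p (2 * k + 1) ξ =
      digitMean 2 (pairNum b p k / (2 * prodRatio b (k + 1)) * ξ) := by
  rw [factorHat, digitCount_odd p k hk, scale_succ, scale_even b p hp_pos hbp k hk,
    ratio_odd b p k hk, pairNum, prodRatio]
  congr 2
  push_cast
  rw [mul_inv, inv_div]
  ring

/-- The index in the convolution of the digits `{0, …, pₖ - 1}`. -/
def digitIndex (k : ℕ) : ℕ := max 1 (2 * k - 2)

theorem factorHat_digitIndex (hp_pos : ∀ k, 1 ≤ k → 1 ≤ p k) (hbp : ∀ k, 1 ≤ k → 2 * p k ≤ b k)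
    {k : ℕ} (hk : 1 ≤ k) (ξ : ℝ) :
    factorHat b p (digitIndex k) ξ = digitMean (p k) ((prodRatio b k)⁻¹ * ξ) := by
  obtain ⟨j, rfl⟩ : ∃ j, k = j + 1 := ⟨k - 1, by omega⟩
  rcases Nat.eq_zero_or_pos j with rfl | hj
  · exact factorHat_one ξ
  · rw [← factorHat_even hp_pos hbp hj]
    congr 1
    simp only [digitIndex]
    omega

/-- The power of `2` in `pₖ` divides `bₖ` for `k ≥ 2`. -/
theorem exists_odd_dvd_mul (hp_pos : ∀ k, 1 ≤ k → 1 ≤ p k) (hbp : ∀ k, 1 ≤ k → 2 * p k ≤ b k)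
    (hp_even : ∀ k, 1 ≤ k → 2 ∣ p k) {Λ : Set ℝ} (hΛ : IsAlmostSpectrum (tailHat b p 0) Λ)
    {k : ℕ} (hk : 2 ≤ k) : ∃ q : ℕ, Odd q ∧ p k ∣ q * b k := by
  by_contra! hq
  have hpk := hp_pos k (by omega)
  have hbk := hbp k (by omega)
  obtain ⟨a, q, hqo, hpq⟩ := Nat.exists_eq_two_pow_mul_odd (n := p k) (by omega)
  obtain ⟨β, r, hro, hbr⟩ := Nat.exists_eq_two_pow_mul_odd (n := b k) (by omega)
  have hβ : β < a := by
    by_contra hle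
    refine hq q hqo ?_
    rw [hpq, hbr, mul_comm q]
    exact mul_dvd_mul ((pow_dvd_pow 2 (by omega)).mul_right r) dvd_rfl
  -- Here `β` is the exponent of `2` in `b k`; if it is smaller than that in `p k`, a two-digit
  -- piece at scale `B / 2 ^ β` can be extracted.
  obtain ⟨r', hr'⟩ : ∃ r', p k = 2 ^ β * (2 * r') := by
    obtain ⟨c, rfl⟩ := Nat.exists_eq_add_of_lt hβ
    exact ⟨2 ^ c * q, by rw [hpq]; ring⟩
  have hr1 : 1 ≤ r' := by
    rcases Nat.eq_zero_or_pos r' with rfl | h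
    · simp at hr'; omega
    · exact h
  obtain ⟨k, rfl⟩ : ∃ j, k = j + 1 := ⟨k - 1, by omega⟩
  have hBpos := prodRatio_pos hp_pos hbp (k + 1)
  have hBpos' := prodRatio_pos hp_pos hbp k
  set B := prodRatio b (k + 1) with hBdef
  have hidx : digitIndex (k + 1) = 2 * k - 1 + 1 := by simp only [digitIndex]; omega
  have hprod : IsFourier fun x => ∏ i ∈ Finset.Icc 1 (2 * k - 1), factorHat b p i x :=
    IsFourier.prod _ fun i hi => isFourier_factorHat hp_pos hbp (Finset.mem_Icc.1 hi).1
  refine hΛ.false_of_digitMean_factor (e := 2) (t := 2 ^ β * B⁻¹)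
    (σ := fun x => ((∏ i ∈ Finset.Icc 1 (2 * k - 1), factorHat b p i x) *
      (digitMean (2 ^ β) (B⁻¹ * x) * digitMean r' (2 * 2 ^ β * B⁻¹ * x))) *
        tailHat b p (2 * k - 1 + 1) x) le_rfl (by positivity) (fun x => ?_)
    ((hprod.mul ((isFourier_digitMean Nat.one_le_two_pow (by positivity)).mul
      (isFourier_digitMean hr1 (by positivity)))).mul (isFourier_tailHat hp_pos hbp _))
    fun x _ y _ h => ?_
  · rw [tailHat_zero_eq_prod_mul hp_pos hbp (2 * k - 1), tailHat_eq_mul hp_pos hbp, ← hidx,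
      factorHat_digitIndex hp_pos hbp (by omega), hr', digitMean_mul, digitMean_mul, ← hBdef]
    push_cast
    simp only [← mul_assoc]
    ring
  · rw [digitMean_eq_zero_iff (by norm_num)] at h
    obtain ⟨⟨j, hj⟩, hni⟩ := h
    push_cast at hj
    -- Going back one scale multiplies the half-odd integer by the odd number `r`. It stays
    -- half-odd, hence a zero of the previous digit mean, whose number of digits is even.
    have hval : (prodRatio b k)⁻¹ * (x - y) = r * (2 ^ β * B⁻¹ * (x - y)) := by
      have h0 : B = prodRatio b k * (2 ^ β * r) := by
        rw [hBdef, prodRatio_succ, hbr]; push_cast; rfl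
      have hr0 : (r : ℝ) ≠ 0 := by
        rintro h1; rw [h1] at h0; simp at h0; exact hBpos.ne' h0
      rw [h0]; field_simp
    have hz : factorHat b p (digitIndex k) (x - y) = 0 := by
      rw [factorHat_digitIndex hp_pos hbp (by omega),
        digitMean_eq_zero_iff (hp_pos k (by omega)), hval]
      obtain ⟨c, hc⟩ := hp_even k (by omega)
      refine ⟨⟨c * r * j, by rw [hc]; push_cast; rw [← hj]; ring⟩, fun ⟨i, hi⟩ => hni ?_⟩
      refine exists_int_of_two_mul ⟨r, by exact_mod_cast hro, i, ?_⟩ hj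
      exact_mod_cast hi
    have hmem : digitIndex k ∈ Finset.Icc 1 (2 * k - 1) := by
      simp only [digitIndex, Finset.mem_Icc]; omega
    rw [Finset.prod_eq_zero hmem hz]
    simp

theorem odd_pairNum {k : ℕ} (h : Even (b (k + 1))) : Odd (pairNum b p k) := by
  have h1 : Even ((b (k + 1) : ℤ) * (2 * p k - 1)) := by
    have : Even (b (k + 1) : ℤ) := by exact_mod_cast h
    exact this.mul_right _
  exact h1.sub_odd odd_one

/-- Some later factor vanishes. For consecutive digits, `p_{j+1} ∣ q b_{j+1}` with `q` odd turns
integrality of `p_{j+1} x / B_{j+1}` into that of `q x / B_j`, where `j ≥ k`. For a pair, the odd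
`pairNum` serves as denominator. -/
theorem mem_oddLocal_of_tailHat_eq_zero (hp_pos : ∀ k, 1 ≤ k → 1 ≤ p k)
    (hbp : ∀ k, 1 ≤ k → 2 * p k ≤ b k)
    (hq : ∀ k, 2 ≤ k → ∃ q : ℕ, Odd q ∧ p k ∣ q * b k) (hb : ∀ k, 2 ≤ k → Even (b k))
    {k : ℕ} (hk : 1 ≤ k) {x : ℝ} (hx : tailHat b p (digitIndex k) x = 0) :
    (prodRatio b k)⁻¹ * x ∈ oddLocal := by
  have hB := prodRatio_pos hp_pos hbp k
  obtain ⟨i, hi, hz⟩ := exists_factorHat_eq_zero hp_pos hbp hx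
  simp only [digitIndex] at hi
  obtain ⟨j, rfl | rfl⟩ := Nat.even_or_odd' i
  · rw [factorHat_even hp_pos hbp (by omega),
      digitMean_eq_zero_iff (hp_pos _ (by omega))] at hz
    obtain ⟨⟨n, hn⟩, -⟩ := hz
    obtain ⟨q, hqo, t, ht⟩ := hq (j + 1) (by omega)
    obtain ⟨N, hN⟩ := exists_prodRatio_eq_mul b (by omega : k ≤ j)
    refine ⟨q, by exact_mod_cast hqo, N * t * n, ?_⟩
    have hBj := prodRatio_pos hp_pos hbp j
    have hBj' := prodRatio_pos hp_pos hbp (j + 1)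
    have htR : (q : ℝ) * b (j + 1) = p (j + 1) * t := by exact_mod_cast ht
    have e1 : (prodRatio b k)⁻¹ = N * (prodRatio b j)⁻¹ := by
      have : (N : ℝ) ≠ 0 := fun h => hBj.ne' (by rw [hN, h, mul_zero])
      rw [hN]; field_simp
    have e2 : (prodRatio b j)⁻¹ = b (j + 1) * (prodRatio b (j + 1))⁻¹ := by
      have : (b (j + 1) : ℝ) ≠ 0 := fun h => hBj'.ne' (by rw [prodRatio_succ, h, mul_zero])
      rw [prodRatio_succ]; field_simp
    push_cast
    rw [e1, e2, ← hn]
    linear_combination (N * (prodRatio b (j + 1))⁻¹ * x) * htR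
  · rw [factorHat_odd hp_pos hbp (by omega), digitMean_eq_zero_iff (by norm_num)] at hz
    obtain ⟨⟨n, hn⟩, -⟩ := hz
    obtain ⟨N, hN⟩ := exists_prodRatio_eq_mul b (by omega : k ≤ j + 1)
    refine ⟨pairNum b p j, odd_pairNum (hb _ (by omega)), N * n, ?_⟩
    have hBj := prodRatio_pos hp_pos hbp (j + 1)
    have : (N : ℝ) ≠ 0 := fun h => hBj.ne' (by rw [hN, h, mul_zero])
    push_cast at hn ⊢
    rw [← hn, hN]
    field_simp

end Moran

end MoranSpectral

/-! ### Peeling all factors in turn. -/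

open MoranSpectral in
theorem theorem5p5 (b p : ℕ → ℕ)
    (hp_pos : ∀ k, 1 ≤ k → 1 ≤ p k)
    (hbp : ∀ k, 1 ≤ k → 2 * p k ≤ b k)
    (hp_even : ∀ k, 1 ≤ k → 2 ∣ p k)
    (hb_bdd : ∃ B : ℕ, ∀ k, 1 ≤ k → b k ≤ B)
    (ν : MeasureTheory.Measure ℝ) [MeasureTheory.IsProbabilityMeasure ν]
    (hν : MoranSpectral.IsInfiniteConvolution (MoranSpectral.factor b p) ν)
    (hspec : MoranSpectral.IsSpectralMeasure ν) :
    p 2 ∣ b 2 ∧ ∀ k, 3 ≤ k → 2 * p k ∣ b k := by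
  obtain ⟨Λ, hΛ⟩ := exists_isAlmostSpectrum hspec
  rw [fourierAt_eq_tailHat hp_pos hbp hν] at hΛ
  have hq : ∀ k, 2 ≤ k → ∃ q : ℕ, Odd q ∧ p k ∣ q * b k := fun k hk =>
    exists_odd_dvd_mul hp_pos hbp hp_even hΛ hk
  have hb : ∀ k, 2 ≤ k → Even (b k) := fun k hk => by
    obtain ⟨q, hqo, h⟩ := hq k hk
    have h2 := even_iff_two_dvd.2 ((hp_even k (by omega)).trans h)
    exact (Nat.even_mul.1 h2).resolve_left (Nat.not_even_iff_odd.2 hqo)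
  have hb0 : ∀ k, 1 ≤ k → b k ≠ 0 := fun k hk => by
    have := hbp k hk
    have := hp_pos k hk
    omega
  have hB := fun k => (prodRatio_pos hp_pos hbp k).ne'
  have hfac : ∀ j x, tailHat b p (2 * j + 1) x
      = digitMean (p (j + 2)) ((prodRatio b (j + 2))⁻¹ * x) * tailHat b p (2 * j + 2) x := by
    intro j x
    rw [tailHat_eq_mul hp_pos hbp, show 2 * j + 1 + 1 = 2 * (j + 1) by ring,
      factorHat_even hp_pos hbp (by omega)]
  have hone : ∃ Λ, IsAlmostSpectrum (tailHat b p 1) Λ ∧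
      ∀ x ∈ Λ, ∀ y ∈ Λ, ∃ n : ℤ, x - y = prodRatio b 1 * n := by
    obtain ⟨Λ', -, h1, h2⟩ := hΛ.split_consecutive (hp_pos 1 le_rfl) (hp_even 1 le_rfl) (hB 1)
      (fun x => by rw [tailHat_eq_mul hp_pos hbp, zero_add, factorHat_one])
      (isFourier_tailHat hp_pos hbp 1)
      fun x hx => mem_oddLocal_of_tailHat_eq_zero hp_pos hbp hq hb le_rfl hx
    exact ⟨Λ', h1, h2⟩
  -- One round removes the `p (j + 2)` consecutive digits and then the pair at the same scale; the
  -- pair doubles the lattice constant.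
  have hstep : ∀ j, (∃ Λ, IsAlmostSpectrum (tailHat b p (2 * j + 1)) Λ) →
      ∃ Λ, IsAlmostSpectrum (tailHat b p (2 * (j + 1) + 1)) Λ ∧
        ∀ x ∈ Λ, ∀ y ∈ Λ, ∃ n : ℤ, x - y = 2 * prodRatio b (j + 2) * n := by
    rintro j ⟨Λ, h⟩
    obtain ⟨Λ', -, h1, h2⟩ := h.split_consecutive (hp_pos _ (by omega)) (hp_even _ (by omega))
      (hB (j + 2)) (hfac j) (isFourier_tailHat hp_pos hbp _) fun x hx =>
        mem_oddLocal_of_tailHat_eq_zero hp_pos hbp hq hb (by omega) (by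
          have e : digitIndex (j + 2) = 2 * j + 2 := by simp only [digitIndex]; omega
          rwa [e])
    obtain ⟨Λ'', -, h3, h4⟩ := h1.split_pair (m := pairNum b p (j + 1))
      (T := tailHat b p (2 * (j + 1) + 1)) (odd_pairNum (hb (j + 1 + 1) (by omega)))
      (hB (j + 1 + 1)) (fun x => by
        rw [tailHat_eq_mul hp_pos hbp, show 2 * j + 2 + 1 = 2 * (j + 1) + 1 by ring,
          factorHat_odd hp_pos hbp (by omega)]) (isFourier_tailHat hp_pos hbp _) h2
    exact ⟨Λ'', h3, h4⟩
  have hall : ∀ j, ∃ Λ, IsAlmostSpectrum (tailHat b p (2 * j + 1)) Λ := by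
    intro j
    induction j with
    | zero => exact hone.imp fun _ h => h.1
    | succ j ih => exact (hstep j ih).imp fun _ h => h.1
  constructor
  · obtain ⟨Λ', h1, h2⟩ := hone
    -- No pair lies between the first two digit blocks, so `L = b 1` without a factor `2`.
    exact h1.dvd (hp_pos 2 (by omega)) (hB 1) (hb0 2 (by omega)) (prodRatio_succ b 1) (hfac 0)
      (isFourier_tailHat hp_pos hbp _) h2
  · intro k hk
    obtain ⟨j, rfl⟩ : ∃ j, k = j + 3 := ⟨k - 3, by omega⟩
    obtain ⟨Λ', h1, h2⟩ := hstep j (hall j)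
    obtain ⟨c, hc⟩ := hb (j + 3) (by omega)
    have hc0 : c ≠ 0 := by
      have := hb0 (j + 3) (by omega)
      omega
    -- The doubled lattice constant halves the quotient of scales: `c = b (j + 3) / 2`, whence the
    -- extra `2` in the conclusion.
    have := h1.dvd (c := c) (hp_pos (j + 3) (by omega)) (mul_ne_zero two_ne_zero (hB (j + 2))) hc0
      (by rw [prodRatio_succ, hc]; push_cast; ring) (hfac (j + 1))
      (isFourier_tailHat hp_pos hbp _) h2
    rw [hc, ← two_mul]
    exact mul_dvd_mul_left 2 this
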